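/- Let $A$ be a factor of type $\mathrm{II}_1$ or of type $\mathrm{III}$, acting on a complex Hilbert space, whose predual $A_*$ (the Banach space of normal linear functionals on $A$) is separable, and regard $A$ as a unital C*-algebra. Then $A$ is simple (it has no closed two-sided ideals other than $0$ and $A$) and is not norm-separable. Its set of pure states has cardinality at least $2^{\mathfrak c}$, and its group $\mathrm{Aut}(A)$ of all $*$-automorphisms has cardinality at most $\mathfrak c$, where $\mathfrak c$ is the cardinality of the continuum. The pure state space of $A$ is not homogeneous under $\mathrm{Aut}(A)$: there are pure states $\omega_1,\omega_2$ of $A$ such that $\omega_2\neq\omega_1\circ\alpha$ for every $\alpha\in\mathrm{Aut}(A)$. -/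

import Mathlib

open scoped ComplexOrder

/-! ### C⋆-algebraic notions -/

section CStar

variable (A : Type*) [NormedRing A] [NormedAlgebra ℂ A] [StarRing A]

/-- The states of a unital C⋆-algebra `A`: the positive linear functionals `f` with `f 1 = 1`. -/
def stateSpace : Set (StrongDual ℂ A) :=
  {f | (∀ a : A, 0 ≤ f (star a * a)) ∧ f 1 = 1}

/-- The pure states of `A`: the extreme points of the convex set of states. -/
def pureStateSpace : Set (StrongDual ℂ A) :=
  (stateSpace A).extremePoints ℝ

/-- The pure state space of `A` is homogeneous under `Aut(A)`, the group of all ⋆-automorphisms: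
any two pure states are related by `ω₂ = ω₁ ∘ α` for some `α ∈ Aut(A)`. -/
def PureStateSpaceHomogeneous : Prop :=
  ∀ ω₁ ∈ pureStateSpace A, ∀ ω₂ ∈ pureStateSpace A,
    ∃ α : A ≃⋆ₐ[ℂ] A, ∀ a : A, ω₂ a = ω₁ (α a)

/-- Simplicity of a C⋆-algebra: `A` is nonzero, and its only closed two-sided ideals are
`0` and `A`. -/
def IsSimpleCStar : Prop :=
  Nontrivial A ∧ ∀ I : TwoSidedIdeal A, IsClosed (I : Set A) → I = ⊥ ∨ I = ⊤

end CStar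

/-! ### Projections -/

section Projections

variable {A : Type*} [Ring A] [StarRing A]

/-- Murray–von Neumann equivalence: `p = u⋆u` and `q = uu⋆` for some `u ∈ A`. -/
def MvNEquiv (p q : A) : Prop :=
  ∃ u : A, star u * u = p ∧ u * star u = q

/-- A projection `p` is finite if it is not equivalent to a proper subprojection of itself
(`p * q = q` says that the projection `q` lies below the projection `p`). -/
def IsFiniteProjection (p : A) : Prop :=
  IsStarProjection p ∧ ∀ q : A, IsStarProjection q → p * q = q → MvNEquiv p q → q = p

/-- A projection `p` is abelian if the corner `pAp` is commutative. -/
def IsAbelianProjection (p : A) : Prop :=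
  IsStarProjection p ∧ ∀ a b : A, (p * a * p) * (p * b * p) = (p * b * p) * (p * a * p)

end Projections

/-! ### Von Neumann algebras -/

namespace VonNeumannAlgebra

variable {H : Type*} [NormedAddCommGroup H] [InnerProductSpace ℂ H] [CompleteSpace H]

/-- A factor: a nonzero von Neumann algebra whose centre consists of the scalars. -/
def IsFactor (M : VonNeumannAlgebra H) : Prop :=
  Nontrivial M.toStarSubalgebra ∧
    ∀ z ∈ M, z ∈ M.commutant → ∃ c : ℂ, z = c • (1 : H →L[ℂ] H)

/-- A factor of type II₁: the unit is a finite projection and there is no nonzero abelian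
projection. -/
def IsTypeII₁Factor (M : VonNeumannAlgebra H) : Prop :=
  M.IsFactor ∧ IsFiniteProjection (1 : M.toStarSubalgebra) ∧
    ∀ p : M.toStarSubalgebra, IsAbelianProjection p → p = 0

/-- A factor of type III: there is no nonzero finite projection. -/
def IsTypeIIIFactor (M : VonNeumannAlgebra H) : Prop :=
  M.IsFactor ∧ ∀ p : M.toStarSubalgebra, IsFiniteProjection p → p = 0

/-- The predual of `M`: the Banach space of normal (ultraweakly continuous) linear functionals
on `M`, which is the norm closure in the dual of `M` of the linear span of the vector functionals
`a ↦ ⟪ξ, a η⟫`. -/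
noncomputable def predual (M : VonNeumannAlgebra H) :
    Submodule ℂ (StrongDual ℂ M.toStarSubalgebra) :=
  (Submodule.span ℂ {f : StrongDual ℂ M.toStarSubalgebra |
    ∃ ξ η : H, ∀ a : M.toStarSubalgebra,
      f a = inner ℂ ξ ((a : H →L[ℂ] H) η)}).topologicalClosure

end VonNeumannAlgebra

/-!
The inhomogeneity of the pure state space is a counting argument: an orbit of `Aut(A)` has at most
`𝔠` elements, while there are at least `2 ^ 𝔠` pure states.

*Few automorphisms.* Automorphisms act on the predual (`comp_automorphism_mem_predual`), so that
with a separable predual an automorphism is determined by countably many elements of a set of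
cardinality at most `𝔠`. The point is that a ⋆-automorphism `α` is normal, and it suffices to see
that `φ = ⟪ξ, α(·) ξ⟫` lies in the predual. Since `α` is an order isomorphism, `φ` preserves
suprema of chains of positive elements. Given `b ≥ 0` nonzero, choose a vector `η` with
`φ(b) < ⟪η, b η⟫`, and a maximal `x₀` in `[0, b]` with `φ(x₀) ≥ ⟪η, x₀ η⟫`. On the elements between
`0` and `d = b - x₀` the functional `φ` is then dominated by the vector state at `η`
(`exists_dominated_below`). By the Cauchy–Schwarz inequality and the Riesz representation theorem
`φ(· √d)` is a vector functional, so `φ(· d)` is in the predual. The `c` for which `φ(· c)` is in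
the predual form a set closed under sums and suprema of chains, hence a maximal one in `[0, 1]`
is the unit. This uses neither spectral projections nor complete additivity.

*Many pure states.* Factors of type II₁ and III have no minimal projections, hence contain an
infinite orthogonal sequence of nonzero projections. Each subset of the index set gives a
projection, and the projections attached to an independent family of `𝔠` subsets can be given any
`0`-`1` pattern of values by vector states, finitely many at a time. Each full pattern cuts out a
nonempty weak-⋆ compact face of the state space, and by the Krein–Milman theorem a pure state lies
in it (`exists_pureState_of_finite`). Non-separability in norm follows: a norm-separable space has
only `𝔠` bounded functionals.

*Simplicity.* A nonzero ideal contains a nonzero projection `e`. By comparison of projections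
(`IsFactor.comparison`) the unit is exhausted by orthogonal copies of `e` and a remainder
equivalent to a subprojection of `e` (`IsFactor.exists_maximal_copies`). In type II₁ there are
finitely many copies, since infinitely many could be shifted. In type III the projection `e` is
infinite and dominates infinitely many orthogonal copies of some `g ≠ 0`. The unit is exhausted by
copies of `g` and a remainder, and these are countably many because the predual is separable, so
that they fit below `e`. Either way the unit belongs to the ideal.
-/

/-! ### Weak limits, spectral cuts and projections in a von Neumann algebra -/

section OperatorTools

open Filter Topology

variable {H : Type*} [NormedAddCommGroup H] [InnerProductSpace ℂ H] [CompleteSpace H]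

/-- Bounded sets of operators are relatively compact in the weak operator topology: along an
ultrafilter, a bounded family of operators converges weakly. -/
theorem exists_weak_limit {ι : Type*} (U : Ultrafilter ι) (T : ι → H →L[ℂ] H) (C : ℝ)
    (hT : ∀ᶠ i in (U : Filter ι), ‖T i‖ ≤ C) :
    ∃ S : H →L[ℂ] H, ∀ x y : H,
      Tendsto (fun i => inner ℂ x (T i y)) (U : Filter ι) (𝓝 (inner ℂ x (S y))) := by
  have hlim : ∀ x y : H, ∃ z ∈ Metric.closedBall (0 : ℂ) (C * ‖x‖ * ‖y‖),
      Tendsto (fun i => inner ℂ (T i x) y) (U : Filter ι) (𝓝 z) := by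
    intro x y
    obtain ⟨z, hz, h⟩ := (isCompact_closedBall (0 : ℂ) (C * ‖x‖ * ‖y‖)).ultrafilter_le_nhds
      (U.map fun i => inner ℂ (T i x) y) (by
        rw [le_principal_iff, Ultrafilter.mem_coe, Ultrafilter.mem_map]
        filter_upwards [hT] with i hi
        simp only [Set.mem_preimage, mem_closedBall_zero_iff]
        calc ‖inner ℂ (T i x) y‖ ≤ ‖T i x‖ * ‖y‖ := norm_inner_le_norm _ _
          _ ≤ (‖T i‖ * ‖x‖) * ‖y‖ := by gcongr; exact (T i).le_opNorm x
          _ ≤ C * ‖x‖ * ‖y‖ := by gcongr)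
    exact ⟨z, hz, h⟩
  choose B hB hBlim using hlim
  let B₁ : H →ₗ⋆[ℂ] H →ₗ[ℂ] ℂ := LinearMap.mk₂'ₛₗ (starRingEnd ℂ) (RingHom.id ℂ) B
    (fun x x' y => tendsto_nhds_unique (hBlim (x + x') y) (by
      simpa [inner_add_left] using (hBlim x y).add (hBlim x' y)))
    (fun c x y => tendsto_nhds_unique (hBlim (c • x) y) (by
      simpa [inner_smul_left, mul_comm] using (hBlim x y).const_mul (starRingEnd ℂ c)))
    (fun x y y' => tendsto_nhds_unique (hBlim x (y + y')) (by
      simpa [inner_add_right] using (hBlim x y).add (hBlim x y')))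
    (fun c x y => tendsto_nhds_unique (hBlim x (c • y)) (by
      simpa [inner_smul_right] using (hBlim x y).const_mul c))
  let B₂ : H →L⋆[ℂ] H →L[ℂ] ℂ := B₁.mkContinuous₂ C fun x y => by
    simpa using! hB x y
  refine ⟨InnerProductSpace.continuousLinearMapOfBilin B₂, fun x y => ?_⟩
  have h1 : inner ℂ (InnerProductSpace.continuousLinearMapOfBilin B₂ y) x = B y x := by
    rw [InnerProductSpace.continuousLinearMapOfBilin_apply]; rfl
  have h2 := (Complex.continuous_conj.tendsto _).comp (hBlim y x)
  rw [← h1, inner_conj_symm] at h2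
  refine h2.congr fun i => ?_
  simp

namespace VonNeumannAlgebra

variable {M : VonNeumannAlgebra H}

theorem smul_mem' (c : ℂ) {a : H →L[ℂ] H} (ha : a ∈ M) : c • a ∈ M :=
  M.toStarSubalgebra.smul_mem ha c

theorem mem_iff_commute {a : H →L[ℂ] H} : a ∈ M ↔ ∀ y ∈ M.commutant, Commute y a := by
  conv_lhs => rw [← commutant_commutant M]
  rw [mem_commutant_iff]
  rfl

/-- A von Neumann algebra is closed under weak limits. -/
theorem mem_of_weak_limit {ι : Type*} {U : Filter ι} [U.NeBot] {T : ι → H →L[ℂ] H}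
    {S : H →L[ℂ] H}
    (hS : ∀ x y : H, Tendsto (fun i => inner ℂ x (T i y)) U (𝓝 (inner ℂ x (S y))))
    (hT : ∀ᶠ i in U, T i ∈ M) : S ∈ M := by
  rw [mem_iff_commute]
  intro y hy
  refine ContinuousLinearMap.ext fun v => ext_inner_left ℂ fun w => ?_
  have h1 := hS (star y w) v
  have h2 := hS w (y v)
  simp only [ContinuousLinearMap.star_eq_adjoint, ContinuousLinearMap.adjoint_inner_left] at h1
  refine tendsto_nhds_unique (h1.congr' ?_) h2
  filter_upwards [hT] with i hi
  have h3 := mem_iff_commute.1 hi y hy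
  have h4 : y (T i v) = T i (y v) := DFunLike.congr_fun h3 v
  rw [h4]

theorem cfc_mem {a : H →L[ℂ] H} (ha : a ∈ M) (f : ℝ → ℝ) : cfc f a ∈ M :=
  mem_iff_commute.2 fun y hy => ((mem_iff_commute.1 ha y hy).symm.cfc_real f).symm

theorem exists_sqrt {a : H →L[ℂ] H} (ha : a ∈ M) (h0 : 0 ≤ a) :
    ∃ c ∈ M, IsSelfAdjoint c ∧ c * c = a := by
  refine ⟨CFC.sqrt a, ?_, (CFC.sqrt_nonneg a).isSelfAdjoint, CFC.sqrt_mul_sqrt_self a⟩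
  rw [CFC.sqrt_eq_real_sqrt a, cfcₙ_eq_cfc]
  exact cfc_mem ha _

/-- The projection onto a closed subspace belongs to `M` as soon as the subspace is invariant
under the commutant. -/
theorem starProjection_mem {K : Submodule ℂ H} [K.HasOrthogonalProjection]
    (hK : ∀ y ∈ M.commutant, ∀ v ∈ K, y v ∈ K) : K.starProjection ∈ M := by
  rw [IsStarProjection.mem_iff isStarProjection_starProjection]
  intro y hy
  rw [Submodule.range_starProjection]
  exact fun v hv => hK y hy v hv

/-- The projection onto the closed span of the ranges of a family of operators. -/
noncomputable def rangeProj {ι : Type*} (b : ι → H →L[ℂ] H) : H →L[ℂ] H :=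
  (⨆ i, (b i).range).topologicalClosure.starProjection

section RangeProj

variable {ι : Type*} {b : ι → H →L[ℂ] H}

theorem isStarProjection_rangeProj : IsStarProjection (rangeProj b) :=
  isStarProjection_starProjection

theorem rangeProj_mul (i : ι) : rangeProj b * b i = b i := by
  ext v
  refine Submodule.starProjection_eq_self_iff.2 (Submodule.le_topologicalClosure _ ?_)
  exact Submodule.mem_iSup_of_mem i ⟨v, rfl⟩

/-- An operator that kills all the ranges kills the projection onto their closed span. -/
theorem mul_rangeProj_eq_zero {y : H →L[ℂ] H} (hy : ∀ i, y * b i = 0) : y * rangeProj b = 0 := by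
  have hle : (⨆ i, (b i).range).topologicalClosure ≤ y.ker := by
    refine Submodule.topologicalClosure_minimal _ (iSup_le fun i => ?_)
      (ContinuousLinearMap.isClosed_ker y)
    rintro _ ⟨v, rfl⟩
    exact DFunLike.congr_fun (hy i) v
  ext v
  exact hle (Submodule.starProjection_apply_mem _ v)

theorem mul_rangeProj_congr {x y : H →L[ℂ] H} (h : ∀ i, x * b i = y * b i) :
    x * rangeProj b = y * rangeProj b := by
  rw [← sub_eq_zero, ← sub_mul]
  exact mul_rangeProj_eq_zero fun i => by rw [sub_mul, h, sub_self]

theorem rangeProj_mem (hb : ∀ i, b i ∈ M) : rangeProj b ∈ M := by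
  refine starProjection_mem fun y hy => ?_
  have hle : (⨆ i, (b i).range).topologicalClosure ≤
      (⨆ i, (b i).range).topologicalClosure.comap (y : H →ₗ[ℂ] H) := by
    refine Submodule.topologicalClosure_minimal _ (iSup_le fun i => ?_) ?_
    · rintro _ ⟨v, rfl⟩
      have h1 : y (b i v) = b i (y v) := DFunLike.congr_fun (mem_iff_commute.1 (hb i) y hy) v
      refine Submodule.le_topologicalClosure _ (Submodule.mem_iSup_of_mem i ⟨y v, ?_⟩)
      simpa using h1.symm
    · exact (Submodule.isClosed_topologicalClosure _).preimage y.continuous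
  exact fun v hv => hle hv

end RangeProj

/-- A spectral cut: below a nonzero positive element `a` of `M` there is a nonzero
projection `e ∈ M` on which `a` is invertible. -/
theorem exists_spectral_cut {a : H →L[ℂ] H} (ha : a ∈ M) (h0 : 0 ≤ a) (hne : a ≠ 0) :
    ∃ e ∈ M, ∃ c ∈ M, IsStarProjection e ∧ e ≠ 0 ∧ IsSelfAdjoint c ∧ c * a * c * e = e ∧
      ∀ y : H →L[ℂ] H, y * a = 0 → y * e = 0 := by
  have hsa : IsSelfAdjoint a := h0.isSelfAdjoint
  have hnn : ∀ x ∈ spectrum ℝ a, 0 ≤ x := fun x hx => spectrum_nonneg_of_nonneg h0 hx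
  set t : ℝ := ‖a‖ / 2 with ht
  have hpos : 0 < ‖a‖ := norm_pos_iff.2 hne
  have htpos : 0 < t := by positivity
  have hmax : ∀ x : ℝ, 0 < max x t := fun x => lt_max_of_lt_right htpos
  set b := cfc (fun x : ℝ => max (x - t) 0) a with hb
  set c := cfc (fun x : ℝ => (Real.sqrt (max x t))⁻¹) a with hc
  have hcont : Continuous fun x : ℝ => (Real.sqrt (max x t))⁻¹ :=
    (by fun_prop : Continuous fun x : ℝ => Real.sqrt (max x t)).inv₀
      fun x => (Real.sqrt_pos.2 (hmax x)).ne'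
  have hbM : b ∈ M := cfc_mem ha _
  have hbne : b ≠ 0 := by
    intro hb0
    have h1 : a = cfc (fun x : ℝ => x - max (x - t) 0) a := by
      rw [cfc_sub (fun x : ℝ => x) (fun x : ℝ => max (x - t) 0) a, cfc_id' ℝ a, ← hb, hb0, sub_zero]
    have h2 : ‖a‖ ≤ t := by
      rw [h1]
      refine norm_cfc_le htpos.le fun x hx => ?_
      have := hnn x hx
      rw [Real.norm_eq_abs, abs_le]
      rcases le_total (x - t) 0 with h | h
      · rw [max_eq_right h]; constructor <;> linarith
      · rw [max_eq_left h]; constructor <;> linarith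
    linarith
  have hcab : c * a * c * b = 1 * b := by
    rw [one_mul]
    calc c * a * c * b = c * cfc (fun x : ℝ => x) a * c * b := by rw [cfc_id' ℝ a]
      _ = b := ?_
    rw [hc, hb, ← cfc_mul _ _ a (hcont.continuousOn) (by fun_prop),
      ← cfc_mul _ _ a (by fun_prop) (hcont.continuousOn), ← cfc_mul _ _ a (by fun_prop) (by fun_prop)]
    refine cfc_congr fun x hx => ?_
    rcases le_total (x - t) 0 with h | h
    · simp [max_eq_right h]
    · have hx : max x t = x := max_eq_left (by linarith)
      have hx0 : 0 < x := by linarith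
      simp only [hx]
      have := Real.mul_self_sqrt hx0.le
      have h3 : Real.sqrt x ≠ 0 := (Real.sqrt_pos.2 hx0).ne'
      rw [show (Real.sqrt x)⁻¹ * x * (Real.sqrt x)⁻¹ = 1 by
        field_simp; nlinarith, one_mul]
  refine ⟨rangeProj fun _ : Unit => b, rangeProj_mem fun _ => hbM, c, cfc_mem ha _,
    isStarProjection_rangeProj, fun he => hbne ?_, cfc_predicate _ a, ?_, fun y hy => ?_⟩
  · rw [← rangeProj_mul (b := fun _ : Unit => b) (), he, zero_mul]
  · simpa using mul_rangeProj_congr (b := fun _ : Unit => b) (fun _ => hcab)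
  · refine mul_rangeProj_eq_zero fun _ => ?_
    -- the cut `max (x - t) 0` is divisible by `x`, so that it vanishes wherever `a` does
    have hdiv : b = a * cfc (fun x : ℝ => max (x - t) 0 / max x t) a := by
      have hc2 : Continuous fun x : ℝ => max (x - t) 0 / max x t :=
        (by fun_prop : Continuous fun x : ℝ => max (x - t) 0).div (by fun_prop)
          fun x => (hmax x).ne'
      calc b = cfc (fun x : ℝ => x) a * cfc (fun x : ℝ => max (x - t) 0 / max x t) a := ?_
        _ = a * cfc (fun x : ℝ => max (x - t) 0 / max x t) a := by rw [cfc_id' ℝ a]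
      rw [← cfc_mul _ _ a (by fun_prop) hc2.continuousOn]
      refine cfc_congr fun x hx => ?_
      rcases le_total (x - t) 0 with h | h
      · simp [max_eq_right h]
      · have hx : max x t = x := max_eq_left (by linarith)
        have hx0 : x ≠ 0 := by linarith
        simp only [hx]
        field_simp
    rw [hdiv, ← mul_assoc, hy, zero_mul]

/-- Every nonzero `x ∈ M` can be turned into a nonzero partial isometry `w = x d`, `d ∈ M`,
whose initial projection is killed by everything that kills `star x * x`. -/
theorem exists_partial_isometry {x : H →L[ℂ] H} (hx : x ∈ M) (hne : x ≠ 0) :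
    ∃ d ∈ M, IsStarProjection (star (x * d) * (x * d)) ∧ x * d ≠ 0 ∧
      ∀ y : H →L[ℂ] H, y * star x = 0 → y * (star (x * d) * (x * d)) = 0 := by
  have hne' : star x * x ≠ 0 := fun h => hne ((CStarRing.star_mul_self_eq_zero_iff x).1 h)
  obtain ⟨e, he, c, hc, hpe, hene, hcs, hcut, hker⟩ :=
    exists_spectral_cut (mul_mem (star_mem hx) hx) (star_mul_self_nonneg x) hne'
  have h1 : star (x * (c * e)) * (x * (c * e)) = e := by
    rw [star_mul, star_mul, hcs.star_eq, hpe.isSelfAdjoint.star_eq]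
    calc e * c * star x * (x * (c * e)) = e * (c * (star x * x) * c * e) := by
          simp only [mul_assoc]
      _ = e := by rw [hcut, hpe.isIdempotentElem.eq]
  refine ⟨c * e, mul_mem hc he, by rwa [h1], fun h => hene ?_, fun y hy => ?_⟩
  · rw [← h1, h, mul_zero]
  · rw [h1]
    exact hker y (by rw [← mul_assoc, hy, zero_mul])

end VonNeumannAlgebra

end OperatorTools

/-! ### Partial isometries and comparison of projections in a factor -/

section Comparison

open Filter Topology

variable {H : Type*} [NormedAddCommGroup H] [InnerProductSpace ℂ H] [CompleteSpace H]

/-- A partial isometry, characterised algebraically by `w w⋆ w = w`. -/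
def IsPartialIsometry (w : H →L[ℂ] H) : Prop := w * star w * w = w

/-- Two operators with orthogonal ranges and orthogonal supports. -/
def AreOrthogonal (w w' : H →L[ℂ] H) : Prop := star w * w' = 0 ∧ w * star w' = 0

theorem AreOrthogonal.symm {w w' : H →L[ℂ] H} (h : AreOrthogonal w w') : AreOrthogonal w' w :=
  ⟨by simpa using congrArg star h.1, by simpa using congrArg star h.2⟩

theorem mul_eq_self_of_sub_eq_zero {R : Type*} [Ring R] {q x : R} (h : (1 - q) * x = 0) :
    q * x = x := by
  rw [sub_mul, one_mul, sub_eq_zero] at h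
  exact h.symm

theorem mul_eq_self_of_sub_eq_zero' {R : Type*} [Ring R] {q x : R} (h : x * (1 - q) = 0) :
    x * q = x := by
  rw [mul_sub, mul_one, sub_eq_zero] at h
  exact h.symm

/-- If the projection `star w * w` is below `p`, then `w` is supported on `p`. -/
theorem mul_eq_self_of_star_mul_self {w p : H →L[ℂ] H} (hp : IsSelfAdjoint p)
    (h : p * (star w * w) = star w * w) : w * p = w := by
  refine mul_eq_self_of_sub_eq_zero' ?_
  rw [← CStarRing.star_mul_self_eq_zero_iff, star_mul, star_sub, star_one, hp.star_eq]
  calc (1 - p) * star w * (w * (1 - p)) = (star w * w - p * (star w * w)) * (1 - p) := by noncomm_ring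
    _ = 0 := by rw [h, sub_self, zero_mul]

theorem isPartialIsometry_of_isStarProjection {w : H →L[ℂ] H}
    (h : IsStarProjection (star w * w)) : IsPartialIsometry w := by
  rw [IsPartialIsometry, mul_assoc]
  exact mul_eq_self_of_star_mul_self h.isSelfAdjoint h.isIdempotentElem.eq

namespace IsPartialIsometry

variable {w : H →L[ℂ] H}

theorem star (hw : IsPartialIsometry w) : IsPartialIsometry (star w) := by
  have := congrArg Star.star hw
  simpa [IsPartialIsometry, mul_assoc] using this

theorem isStarProjection (hw : IsPartialIsometry w) : IsStarProjection (Star.star w * w) :=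
  ⟨by rw [IsIdempotentElem, mul_assoc, ← mul_assoc w, hw], .star_mul_self w⟩

theorem isStarProjection' (hw : IsPartialIsometry w) : IsStarProjection (w * Star.star w) := by
  simpa using hw.star.isStarProjection

end IsPartialIsometry

theorem norm_sum_le_one_of_orthogonal {ι : Type*} (w : ι → H →L[ℂ] H)
    (hw : ∀ i, IsPartialIsometry (w i)) (ho : Pairwise fun i j => AreOrthogonal (w i) (w j))
    (F : Finset ι) : ‖∑ i ∈ F, w i‖ ≤ 1 := by
  classical
  have h1 : ∀ i ∈ F, (∑ j ∈ F, w j) * star (w i) = w i * star (w i) := by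
    intro i hi
    rw [Finset.sum_mul]
    exact Finset.sum_eq_single_of_mem i hi fun j _ hj => (ho hj).2
  have h2 : IsPartialIsometry (∑ i ∈ F, w i) := by
    rw [IsPartialIsometry, star_sum, Finset.mul_sum F (fun i => star (w i)),
      Finset.sum_congr rfl h1, Finset.sum_mul]
    refine Finset.sum_congr rfl fun i hi => ?_
    rw [mul_assoc, Finset.mul_sum, Finset.sum_eq_single_of_mem i hi fun j _ hj => (ho hj.symm).1,
      ← mul_assoc]
    exact hw i
  have h3 := h2.isStarProjection.norm_le
  rw [CStarRing.norm_star_mul_self] at h3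
  nlinarith [norm_nonneg (∑ i ∈ F, w i)]

namespace VonNeumannAlgebra

variable {M : VonNeumannAlgebra H}

/-- The sum of a family of partial isometries in `M` with pairwise orthogonal ranges and
pairwise orthogonal supports. -/
theorem exists_sum_partial_isometry {ι : Type*} (w : ι → H →L[ℂ] H) (hM : ∀ i, w i ∈ M)
    (hw : ∀ i, IsPartialIsometry (w i)) (ho : Pairwise fun i j => AreOrthogonal (w i) (w j)) :
    ∃ u ∈ M, IsPartialIsometry u ∧ (∀ y, (∀ i, y * w i = 0) → y * u = 0) ∧
      (∀ y, (∀ i, w i * y = 0) → u * y = 0) ∧ (∀ i, star u * u * star (w i) = star (w i)) ∧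
      ∀ i, u * star u * w i = w i := by
  classical
  let U : Ultrafilter (Finset ι) := Ultrafilter.of atTop
  have hU : (U : Filter (Finset ι)) ≤ atTop := Ultrafilter.of_le _
  obtain ⟨u, hu⟩ := exists_weak_limit U (fun F => ∑ i ∈ F, w i) 1
    (Eventually.of_forall fun F => norm_sum_le_one_of_orthogonal w hw ho F)
  have huM : u ∈ M := mem_of_weak_limit hu
    (Eventually.of_forall fun F => sum_mem fun i _ => hM i)
  -- identities satisfied by all large partial sums pass to the weak limit
  have hpass : ∀ x y z : H →L[ℂ] H,
      (∀ᶠ F : Finset ι in atTop, x * (∑ i ∈ F, w i) * y = z) → x * u * y = z := by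
    intro x y z h
    refine ContinuousLinearMap.ext fun v => ext_inner_left ℂ fun v' => ?_
    have h1 := hu (star x v') (y v)
    simp only [ContinuousLinearMap.star_eq_adjoint, ContinuousLinearMap.adjoint_inner_left] at h1
    refine tendsto_nhds_unique h1 (tendsto_const_nhds.congr' ?_)
    filter_upwards [hU h] with F hF
    rw [← hF]; rfl
  have hl : ∀ y, (∀ i, y * w i = 0) → y * u = 0 := fun y hy => by
    have := hpass y 1 0 (Eventually.of_forall fun F => by
      rw [Finset.mul_sum, Finset.sum_eq_zero fun i _ => hy i, zero_mul])
    rwa [mul_one] at this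
  have hr : ∀ y, (∀ i, w i * y = 0) → u * y = 0 := fun y hy => by
    have := hpass 1 y 0 (Eventually.of_forall fun F => by
      rw [one_mul, Finset.sum_mul, Finset.sum_eq_zero fun i _ => hy i])
    rwa [one_mul] at this
  have hi1 : ∀ i, u * star (w i) = w i * star (w i) := fun i => by
    have := hpass 1 (star (w i)) (w i * star (w i)) (by
      filter_upwards [eventually_ge_atTop {i}] with F hF
      rw [one_mul, Finset.sum_mul]
      exact Finset.sum_eq_single_of_mem i (hF (Finset.mem_singleton_self i)) fun j _ hj => (ho hj).2)
    rwa [one_mul] at this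
  have hi2 : ∀ i, star u * w i = star (w i) * w i := fun i => by
    have := hpass (star (w i)) 1 (star (w i) * w i) (by
      filter_upwards [eventually_ge_atTop {i}] with F hF
      rw [mul_one, Finset.mul_sum]
      exact Finset.sum_eq_single_of_mem i (hF (Finset.mem_singleton_self i))
        fun j _ hj => (ho hj.symm).1)
    rw [mul_one] at this
    simpa using congrArg star this
  have hi3 : ∀ i, star u * u * star (w i) = star (w i) := fun i => by
    rw [mul_assoc, hi1, ← mul_assoc, hi2]
    simpa [IsPartialIsometry] using (hw i).star
  have hi4 : ∀ i, u * star u * w i = w i := fun i => by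
    rw [mul_assoc, hi2, ← mul_assoc, hi1]
    exact hw i
  refine ⟨u, huM, ?_, hl, hr, hi3, hi4⟩
  refine mul_eq_self_of_sub_eq_zero (hl _ fun i => ?_)
  rw [sub_mul, hi4, one_mul, sub_self]

/-- In a factor, any two nonzero elements are linked: the projection onto the closed
span of the ranges of the `x p`, `x ∈ M`, is central, hence scalar. -/
theorem IsFactor.exists_mul_mul_ne_zero (hM : M.IsFactor) {p q : H →L[ℂ] H} (hp : p ∈ M)
    (hp0 : p ≠ 0) (hq0 : q ≠ 0) : ∃ x ∈ M, q * x * p ≠ 0 := by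
  by_contra! hall
  let b : M → H →L[ℂ] H := fun x => (x : H →L[ℂ] H) * p
  have heM : rangeProj b ∈ M := rangeProj_mem fun x => mul_mem x.2 hp
  have hinv : ∀ y ∈ M, rangeProj b * y * rangeProj b = y * rangeProj b := fun y hy =>
    mul_rangeProj_congr fun x => by
      have := rangeProj_mul (b := b) ⟨y * x, mul_mem hy x.2⟩
      simpa only [b, mul_assoc] using this
  have hcomm : rangeProj b ∈ M.commutant := by
    rw [mem_commutant_iff]
    intro y hy
    have h1 := congrArg star (hinv (star y) (star_mem hy))
    have hs : star (rangeProj b) = rangeProj b := isStarProjection_rangeProj.isSelfAdjoint.star_eq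
    simp only [star_mul, star_star, hs] at h1
    rw [← hinv y hy, mul_assoc, h1]
  obtain ⟨c, hc⟩ := hM.2 _ heM hcomm
  have hq : q * rangeProj b = 0 := mul_rangeProj_eq_zero fun x => by
    simpa only [b, mul_assoc] using hall x x.2
  rw [hc, mul_smul_comm, mul_one, smul_eq_zero_iff_left hq0] at hq
  have h1 := rangeProj_mul (b := b) ⟨1, one_mem M⟩
  rw [hc, hq, zero_smul, zero_mul] at h1
  exact hp0 (by simpa [b] using h1.symm)

theorem IsFactor.exists_partial_isometry_between (hM : M.IsFactor) {p q : H →L[ℂ] H}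
    (hp : p ∈ M) (hq : q ∈ M) (hp' : IsStarProjection p) (hq' : IsStarProjection q)
    (hp0 : p ≠ 0) (hq0 : q ≠ 0) :
    ∃ w ∈ M, IsPartialIsometry w ∧ w ≠ 0 ∧ q * w = w ∧ w * p = w := by
  obtain ⟨x, hx, hne⟩ := hM.exists_mul_mul_ne_zero hp hp0 hq0
  have hz : q * x * p ∈ M := mul_mem (mul_mem hq hx) hp
  obtain ⟨d, hd, hproj, hne', hker⟩ := exists_partial_isometry hz hne
  refine ⟨q * x * p * d, mul_mem hz hd, isPartialIsometry_of_isStarProjection hproj, hne', ?_, ?_⟩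
  · simp only [← mul_assoc, hq'.isIdempotentElem.eq]
  · refine mul_eq_self_of_star_mul_self hp'.isSelfAdjoint (mul_eq_self_of_sub_eq_zero (hker _ ?_))
    rw [star_mul, hp'.isSelfAdjoint.star_eq, ← mul_assoc, sub_mul, one_mul,
      hp'.isIdempotentElem.eq, sub_self, zero_mul]

theorem _root_.IsStarProjection.sub_of_mul_eq_self {p e : H →L[ℂ] H} (hp : IsStarProjection p)
    (he : IsStarProjection e) (h : p * e = e) : IsStarProjection (p - e) := by
  have h' : e * p = e := by
    simpa [he.isSelfAdjoint.star_eq, hp.isSelfAdjoint.star_eq] using congrArg star h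
  refine ⟨?_, hp.isSelfAdjoint.sub he.isSelfAdjoint⟩
  rw [IsIdempotentElem, sub_mul, mul_sub, mul_sub, h, h', hp.isIdempotentElem.eq,
    he.isIdempotentElem.eq, sub_self, sub_zero]

/-- Comparison of projections in a factor: one of the two projections is equivalent to a
subprojection of the other. -/
theorem IsFactor.comparison (hM : M.IsFactor) {p q : H →L[ℂ] H}
    (hp : p ∈ M) (hq : q ∈ M) (hp' : IsStarProjection p) (hq' : IsStarProjection q) :
    ∃ u ∈ M, IsPartialIsometry u ∧ q * u = u ∧ u * p = u ∧
      (star u * u = p ∨ u * star u = q) := by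
  -- a maximal orthogonal set of partial isometries from `p` to `q`
  obtain ⟨T, hT⟩ := zorn_subset
    {T : Set (H →L[ℂ] H) | (∀ w ∈ T, w ∈ M ∧ IsPartialIsometry w ∧ q * w = w ∧ w * p = w) ∧
      T.Pairwise AreOrthogonal} (by
    intro c hc hchain
    refine ⟨⋃₀ c, ⟨?_, ?_⟩, fun s hs => Set.subset_sUnion_of_mem hs⟩
    · rintro w ⟨s, hs, hws⟩
      exact (hc hs).1 w hws
    · exact (Set.pairwise_sUnion hchain.directedOn).2 fun s hs => (hc hs).2)
  obtain ⟨hTw, hTo⟩ := hT.prop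
  obtain ⟨u, huM, hu, hl, hr, hi3, hi4⟩ := exists_sum_partial_isometry (M := M)
    (fun w : T => (w : H →L[ℂ] H)) (fun w => (hTw w w.2).1) (fun w => (hTw w w.2).2.1)
    (fun w w' hne => hTo w.2 w'.2 (Subtype.coe_injective.ne hne))
  have hqu : q * u = u := mul_eq_self_of_sub_eq_zero (hl _ fun w => by
    rw [sub_mul, one_mul, (hTw w w.2).2.2.1, sub_self])
  have hup : u * p = u := mul_eq_self_of_sub_eq_zero' (hr _ fun w => by
    rw [mul_sub, mul_one, (hTw w w.2).2.2.2, sub_self])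
  refine ⟨u, huM, hu, hqu, hup, ?_⟩
  by_contra! hne
  have hpu : p * (star u * u) = star u * u := by
    have := congrArg star hup
    rw [star_mul, hp'.isSelfAdjoint.star_eq] at this
    rw [← mul_assoc, this]
  have hqu' : q * (u * star u) = u * star u := by rw [← mul_assoc, hqu]
  obtain ⟨w, hwM, hw, hw0, hqw, hwp⟩ := hM.exists_partial_isometry_between
    (sub_mem hp (mul_mem (star_mem huM) huM)) (sub_mem hq (mul_mem huM (star_mem huM)))
    (hp'.sub_of_mul_eq_self hu.isStarProjection hpu)
    (hq'.sub_of_mul_eq_self hu.isStarProjection' hqu')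
    (sub_ne_zero.2 hne.1.symm) (sub_ne_zero.2 hne.2.symm)
  have hq0 : ∀ w' ∈ T, (q - u * star u) * w' = 0 := fun w' hw' => by
    rw [sub_mul, (hTw w' hw').2.2.1, hi4 ⟨w', hw'⟩, sub_self]
  have hp0 : ∀ w' ∈ T, (p - star u * u) * star w' = 0 := fun w' hw' => by
    have := congrArg star (hTw w' hw').2.2.2
    rw [star_mul, hp'.isSelfAdjoint.star_eq] at this
    rw [sub_mul, this, hi3 ⟨w', hw'⟩, sub_self]
  have hstar : star w * (q - u * star u) = star w := by
    have := congrArg star hqw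
    rwa [star_mul, star_sub, star_mul, star_star, hq'.isSelfAdjoint.star_eq] at this
  have horth : ∀ w' ∈ T, AreOrthogonal w w' := fun w' hw' =>
    ⟨by rw [← hstar, mul_assoc, hq0 w' hw', mul_zero],
      by rw [← hwp, mul_assoc, hp0 w' hw', mul_zero]⟩
  have hins : insert w T ∈ {T : Set (H →L[ℂ] H) | (∀ w ∈ T, w ∈ M ∧ IsPartialIsometry w ∧
      q * w = w ∧ w * p = w) ∧ T.Pairwise AreOrthogonal} := by
    refine ⟨?_, hTo.insert fun w' hw' _ => ⟨horth w' hw', (horth w' hw').symm⟩⟩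
    rintro w' (rfl | hw')
    · refine ⟨hwM, hw, ?_, ?_⟩
      · rw [← hqw, ← mul_assoc, mul_sub, hq'.isIdempotentElem.eq, hqu']
      · rw [← hwp, mul_assoc, sub_mul, hp'.isIdempotentElem.eq, mul_assoc, hup]
    · exact hTw w' hw'
  have hwT : w ∈ T := hT.2 hins (Set.subset_insert w T) (Set.mem_insert w T)
  exact hw0 (by rw [← hqw, hq0 w hwT])

/-- A maximal family of pairwise orthogonal copies of a nonzero projection `e` in a factor: what
remains of the unit is equivalent to a subprojection of `e`. -/
theorem IsFactor.exists_maximal_copies (hM : M.IsFactor) {e : H →L[ℂ] H} (he : e ∈ M)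
    (he' : IsStarProjection e) (he0 : e ≠ 0) :
    ∃ T : Set (H →L[ℂ] H), (∀ w ∈ T, w ∈ M ∧ star w * w = e) ∧
      T.Pairwise (fun w w' => star w * w' = 0) ∧
      ∃ v ∈ M, star v * v = 1 - rangeProj (fun w : T => (w : H →L[ℂ] H)) ∧ e * v = v := by
  obtain ⟨T, hT⟩ := zorn_subset
    {T : Set (H →L[ℂ] H) | (∀ w ∈ T, w ∈ M ∧ star w * w = e) ∧
      T.Pairwise (fun w w' => star w * w' = 0)} (by
    intro c hc hchain
    refine ⟨⋃₀ c, ⟨?_, ?_⟩, fun s hs => Set.subset_sUnion_of_mem hs⟩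
    · rintro w ⟨s, hs, hws⟩
      exact (hc hs).1 w hws
    · exact (Set.pairwise_sUnion hchain.directedOn).2 fun s hs => (hc hs).2)
  obtain ⟨hTw, hTo⟩ := hT.prop
  refine ⟨T, hTw, hTo, ?_⟩
  set R := rangeProj (fun w : T => (w : H →L[ℂ] H)) with hR
  have hRM : R ∈ M := rangeProj_mem fun w => (hTw w w.2).1
  have hRp : IsStarProjection (1 - R) := isStarProjection_rangeProj.one_sub
  have hRw : ∀ w ∈ T, (1 - R) * w = 0 := fun w hw => by
    rw [sub_mul, one_mul, sub_eq_zero]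
    exact (rangeProj_mul (b := fun w : T => (w : H →L[ℂ] H)) ⟨w, hw⟩).symm
  obtain ⟨u, huM, hu, hqu, hup, h | h⟩ :=
    hM.comparison (sub_mem (one_mem M) hRM) he hRp he'
  · exact ⟨u, huM, h, hqu⟩
  · exfalso
    have hRu : (1 - R) * star u = star u := by
      have := congrArg star hup
      rwa [star_mul, hRp.isSelfAdjoint.star_eq] at this
    have horth : ∀ w ∈ T, star (star u) * w = 0 := fun w hw => by
      rw [star_star, ← hup, mul_assoc, hRw w hw, mul_zero]
    have hins : insert (star u) T ∈ {T : Set (H →L[ℂ] H) | (∀ w ∈ T, w ∈ M ∧ star w * w = e) ∧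
        T.Pairwise (fun w w' => star w * w' = 0)} := by
      refine ⟨?_, hTo.insert fun w hw _ => ⟨horth w hw, by simpa using congrArg star (horth w hw)⟩⟩
      rintro w (rfl | hw)
      · exact ⟨star_mem huM, by rw [star_star, h]⟩
      · exact hTw w hw
    have huT : star u ∈ T := hT.2 hins (Set.subset_insert _ T) (Set.mem_insert _ T)
    have h0 : star u = 0 := by rw [← hRu, hRw _ huT]
    exact he0 (by rw [← h, h0, mul_zero])

end VonNeumannAlgebra

end Comparison

/-! ### Vector functionals and separability of the predual -/

section Simple

open Filter Topology

variable {H : Type*} [NormedAddCommGroup H] [InnerProductSpace ℂ H] [CompleteSpace H]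

namespace VonNeumannAlgebra

variable {M : VonNeumannAlgebra H}

/-- The vector functional `a ↦ ⟪ξ, a η⟫` on `M`. -/
noncomputable def vectorFunctional (M : VonNeumannAlgebra H) (ξ η : H) :
    StrongDual ℂ M.toStarSubalgebra :=
  LinearMap.mkContinuous
    { toFun := fun a => inner ℂ ξ ((a : H →L[ℂ] H) η)
      map_add' := fun a b => by simp
      map_smul' := fun c a => by simp } (‖ξ‖ * ‖η‖) (fun a => by
      calc ‖inner ℂ ξ ((a : H →L[ℂ] H) η)‖ ≤ ‖ξ‖ * ‖(a : H →L[ℂ] H) η‖ := norm_inner_le_norm _ _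
        _ ≤ ‖ξ‖ * (‖(a : H →L[ℂ] H)‖ * ‖η‖) := by gcongr; exact (a : H →L[ℂ] H).le_opNorm η
        _ = ‖ξ‖ * ‖η‖ * ‖a‖ := by rw [AddSubgroupClass.coe_norm]; ring)

@[simp]
theorem vectorFunctional_apply (ξ η : H) (a : M.toStarSubalgebra) :
    vectorFunctional M ξ η a = inner ℂ ξ ((a : H →L[ℂ] H) η) := rfl

theorem vectorFunctional_mem_predual (ξ η : H) : vectorFunctional M ξ η ∈ M.predual :=
  Submodule.le_topologicalClosure _ (Submodule.subset_span ⟨ξ, η, fun _ => rfl⟩)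

theorem exists_dense_sequence_predual (hsep : TopologicalSpace.SeparableSpace M.predual) :
    ∃ φ : ℕ → StrongDual ℂ M.toStarSubalgebra, (∀ n, φ n ∈ M.predual) ∧
      ∀ ψ ∈ M.predual, ∀ ε > 0, ∃ n, ‖ψ - φ n‖ < ε := by
  refine ⟨fun n => (TopologicalSpace.denseSeq M.predual n : StrongDual ℂ M.toStarSubalgebra),
    fun n => (TopologicalSpace.denseSeq M.predual n).2, fun ψ hψ ε hε => ?_⟩
  obtain ⟨n, hx⟩ := (TopologicalSpace.denseRange_denseSeq M.predual).exists_dist_lt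
    ⟨ψ, hψ⟩ hε
  refine ⟨n, ?_⟩
  rwa [Subtype.dist_eq, dist_eq_norm] at hx

/-- An algebra with separable predual is countably decomposable: nonzero partial isometries with
pairwise orthogonal ranges form a countable set. -/
theorem exists_injective_nat_of_orthogonal (hsep : TopologicalSpace.SeparableSpace M.predual)
    {T : Set (H →L[ℂ] H)} (hT : ∀ w ∈ T, w ∈ M ∧ IsPartialIsometry w ∧ w ≠ 0)
    (ho : T.Pairwise (fun w w' => star w * w' = 0)) : ∃ k : T → ℕ, Function.Injective k := by
  obtain ⟨φ, -, hφ⟩ := exists_dense_sequence_predual hsep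
  have hvec : ∀ w : T, ∃ ξ : H, ‖ξ‖ = 1 ∧ (w * star (w : H →L[ℂ] H)) ξ = ξ := by
    intro w
    obtain ⟨η, hη⟩ : ∃ η, (w : H →L[ℂ] H) η ≠ 0 := by
      by_contra! h
      exact (hT w w.2).2.2 (ContinuousLinearMap.ext h)
    refine ⟨((‖(w : H →L[ℂ] H) η‖⁻¹ : ℝ) : ℂ) • (w : H →L[ℂ] H) η, ?_, ?_⟩
    · rw [norm_smul, Complex.norm_real, norm_inv, norm_norm, inv_mul_cancel₀ (norm_ne_zero_iff.2 hη)]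
    · rw [map_smul]
      congr 1
      exact DFunLike.congr_fun (hT w w.2).2.1 η
  choose ξ hξ1 hξ using hvec
  choose k hk using fun w : T =>
    hφ (vectorFunctional M (ξ w) (ξ w)) (vectorFunctional_mem_predual _ _) (1 / 2) (by norm_num)
  refine ⟨k, fun w w' hkk => ?_⟩
  by_contra hne
  have horth : (w * star (w : H →L[ℂ] H)) (ξ w') = 0 := by
    rw [← hξ w', ← mul_apply_eq_comp]
    rw [show (w * star (w : H →L[ℂ] H)) * (w' * star (w' : H →L[ℂ] H)) =
      w * (star (w : H →L[ℂ] H) * w') * star (w' : H →L[ℂ] H) by noncomm_ring,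
      ho w.2 w'.2 (Subtype.coe_injective.ne hne)]
    simp
  set p : M.toStarSubalgebra := ⟨w * star (w : H →L[ℂ] H), mul_mem (hT w w.2).1
    (star_mem (s := M) (hT w w.2).1)⟩ with hp
  have hpn : ‖p‖ ≤ 1 := (hT w w.2).2.1.isStarProjection'.norm_le
  set ψ := vectorFunctional M (ξ w) (ξ w) - vectorFunctional M (ξ w') (ξ w') with hψ
  have hdist : ‖ψ‖ < 1 := by
    have h1 := hk w
    have h2 := hk w'
    rw [← hkk] at h2
    calc ‖ψ‖ = ‖(vectorFunctional M (ξ w) (ξ w) - φ (k w)) -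
          (vectorFunctional M (ξ w') (ξ w') - φ (k w))‖ := by rw [sub_sub_sub_cancel_right]
      _ ≤ _ := norm_sub_le _ _
      _ < 1 := by linarith
  have hval : ψ p = 1 := by
    have h1 : inner ℂ (ξ w) ((p : H →L[ℂ] H) (ξ w)) = 1 := by
      rw [hp, hξ w, inner_self_eq_norm_sq_to_K, hξ1 w]; simp
    have h2 : inner ℂ (ξ w') ((p : H →L[ℂ] H) (ξ w')) = 0 := by
      rw [hp, horth, inner_zero_right]
    calc ψ p = inner ℂ (ξ w) ((p : H →L[ℂ] H) (ξ w)) - inner ℂ (ξ w') ((p : H →L[ℂ] H) (ξ w')) := rfl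
      _ = 1 := by rw [h1, h2, sub_zero]
  have := ψ.le_opNorm p
  rw [hval, norm_one] at this
  nlinarith [norm_nonneg ψ, norm_nonneg p]

/-! ### Simplicity -/

/-- A nonzero two-sided ideal of a von Neumann algebra contains a nonzero projection. -/
theorem exists_projection_mem_ideal (I : TwoSidedIdeal M.toStarSubalgebra) (hI : I ≠ ⊥) :
    ∃ e : M.toStarSubalgebra, e ∈ I ∧ IsStarProjection (e : H →L[ℂ] H) ∧ (e : H →L[ℂ] H) ≠ 0 := by
  obtain ⟨x, hxI, hx0⟩ : ∃ x ∈ I, x ≠ 0 := by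
    by_contra! h
    exact hI (le_bot_iff.1 fun x hx => (TwoSidedIdeal.mem_bot _).2 (h x hx))
  obtain ⟨d, hd, hproj, hne, -⟩ := exists_partial_isometry (M := M) x.2
    (fun h => hx0 (Subtype.ext h))
  let d' : M.toStarSubalgebra := ⟨d, hd⟩
  exact ⟨star (x * d') * (x * d'), I.mul_mem_left _ _ (I.mul_mem_right _ _ hxI), hproj,
    fun h => hne ((CStarRing.star_mul_self_eq_zero_iff _).1 h)⟩

/-- An infinite family of orthogonal copies of a nonzero projection makes the unit infinite, by
shifting the family by one place. -/
theorem not_isFiniteProjection_one {e : H →L[ℂ] H} (he0 : e ≠ 0)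
    (he : IsStarProjection e) (w : ℕ → H →L[ℂ] H) (hwM : ∀ n, w n ∈ M)
    (hw : ∀ n, star (w n) * w n = e) (ho : Pairwise fun m n => star (w m) * w n = 0) :
    ¬ IsFiniteProjection (1 : M.toStarSubalgebra) := by
  intro hfin
  have hwe : ∀ n, w n * e = w n := fun n => mul_eq_self_of_star_mul_self he.isSelfAdjoint
    (by rw [hw, he.isIdempotentElem.eq])
  have hs : ∀ n, star (w (n + 1) * star (w n)) = w n * star (w (n + 1)) := fun n => by simp
  obtain ⟨u, huM, hu, hl, -, hi3, -⟩ := exists_sum_partial_isometry (M := M)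
    (fun n => w (n + 1) * star (w n)) (fun n => mul_mem (hwM _) (star_mem (hwM _)))
    (fun n => by
      rw [IsPartialIsometry, hs]
      calc w (n + 1) * star (w n) * (w n * star (w (n + 1))) * (w (n + 1) * star (w n))
          = w (n + 1) * (star (w n) * w n) * (star (w (n + 1)) * w (n + 1)) * star (w n) := by
            noncomm_ring
        _ = w (n + 1) * star (w n) := by rw [hw, hw, hwe, hwe])
    (fun m n hmn => by
      refine ⟨?_, ?_⟩
      · rw [hs, mul_assoc, ← mul_assoc (star (w (m + 1))), ho (by simpa using hmn)]; simp
      · rw [hs, mul_assoc, ← mul_assoc (star (w m)), ho hmn]; simp)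
  set P := star u * u with hP
  have hPp : IsStarProjection P := hu.isStarProjection
  have hPM : P ∈ M := mul_mem (star_mem huM) huM
  have hPw : ∀ n, P * w n = w n := fun n => by
    have h1 := congrArg (· * w (n + 1)) (hi3 n)
    simp only [hs] at h1
    rwa [mul_assoc, mul_assoc (w n), hw, hwe] at h1
  have hPu : (1 - P) * u = 0 := hl _ fun n => by
    rw [← mul_assoc, sub_mul, one_mul, hPw, sub_self, zero_mul]
  have hPu' : star u * (1 - P) = 0 := by
    have := congrArg star hPu
    rwa [star_mul, star_zero, hPp.one_sub.isSelfAdjoint.star_eq] at this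
  have h0u : star (w 0) * u = 0 := hl _ fun n => by
    rw [← mul_assoc, ho (by simp), zero_mul]
  have h0P : star (w 0) * (1 - P) = 0 := by
    have := congrArg star (hPw 0)
    rw [star_mul, hPp.isSelfAdjoint.star_eq] at this
    rw [mul_sub, mul_one, this, sub_self]
  let V : M.toStarSubalgebra := ⟨u + (1 - P), add_mem huM (sub_mem (one_mem M) hPM)⟩
  have hV : star V * V = 1 := Subtype.ext <| by
    change star (u + (1 - P)) * (u + (1 - P)) = 1
    rw [star_add, hPp.one_sub.isSelfAdjoint.star_eq, add_mul, mul_add, mul_add, hPu, hPu',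
      hPp.one_sub.isIdempotentElem.eq, ← hP]
    abel
  have hVV : V * star V = 1 := by
    refine hfin.2 (V * star V) ⟨?_, .mul_star_self V⟩ (one_mul _) ⟨V, hV, rfl⟩
    rw [IsIdempotentElem, mul_assoc, ← mul_assoc (star V), hV, one_mul]
  have hw0 : star (w 0) = 0 := by
    have h1 : (u + (1 - P)) * star (u + (1 - P)) = 1 := congrArg Subtype.val hVV
    rw [← mul_one (star (w 0)), ← h1, ← mul_assoc, mul_add, h0u, h0P, add_zero, zero_mul]
  exact he0 (by rw [← hw 0, hw0, zero_mul])

theorem IsTypeII₁Factor.one_mem_ideal (hM : M.IsTypeII₁Factor)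
    (I : TwoSidedIdeal M.toStarSubalgebra) (hI : I ≠ ⊥) : 1 ∈ I := by
  obtain ⟨e, heI, he, he0⟩ := exists_projection_mem_ideal I hI
  obtain ⟨T, hTw, hTo, v, hvM, hv, hev⟩ := hM.1.exists_maximal_copies e.2 he he0
  by_cases hfin : T.Finite
  · -- finitely many copies of `e` and a subprojection of `e` sum to the unit
    have hwe : ∀ w ∈ T, w * e = w := fun w hw => mul_eq_self_of_star_mul_self he.isSelfAdjoint
      (by rw [(hTw w hw).2, he.isIdempotentElem.eq])
    have hfin' := hfin.fintype
    let W : T → M.toStarSubalgebra := fun w => ⟨w, (hTw w w.2).1⟩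
    let v' : M.toStarSubalgebra := ⟨v, hvM⟩
    have hWI : ∀ w, W w * star (W w) ∈ I := fun w => by
      have : W w * e = W w := Subtype.ext (hwe w w.2)
      rw [← this]
      exact I.mul_mem_right _ _ (I.mul_mem_left _ _ heI)
    have hvI : star v' * v' ∈ I := by
      have : e * v' = v' := Subtype.ext hev
      rw [← this]
      exact I.mul_mem_left _ _ (I.mul_mem_right _ _ heI)
    set R := rangeProj (fun w : T => (w : H →L[ℂ] H)) with hR
    have hRp : IsStarProjection R := isStarProjection_rangeProj
    set S : H →L[ℂ] H := ∑ w : T, (w : H →L[ℂ] H) * star (w : H →L[ℂ] H) with hS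
    have hsum : R = S := by
      have h1 : S * R = 1 * R := mul_rangeProj_congr fun w => by
        rw [one_mul, hS, Finset.sum_mul, Finset.sum_eq_single_of_mem w (Finset.mem_univ w)
          fun w' _ hne => by
            rw [mul_assoc, hTo w'.2 w.2 (Subtype.coe_injective.ne hne), mul_zero],
          mul_assoc, (hTw w w.2).2, hwe w w.2]
      have h2 : R * S = S := by
        rw [hS, Finset.mul_sum]
        exact Finset.sum_congr rfl fun w _ => by
          rw [← mul_assoc, rangeProj_mul (b := fun w : T => (w : H →L[ℂ] H)) w]
      have h3 : star S = S := by simp [hS, star_sum]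
      have h4 := congrArg star h2
      rw [star_mul, h3, hRp.isSelfAdjoint.star_eq, h1, one_mul] at h4
      exact h4
    have hone : (1 : M.toStarSubalgebra) = ∑ w : T, W w * star (W w) + star v' * v' := by
      refine Subtype.ext ?_
      have h1 : ((∑ w : T, W w * star (W w) : M.toStarSubalgebra) : H →L[ℂ] H) = S := by
        rw [AddSubmonoidClass.coe_finsetSum]; rfl
      have h2 : ((star v' * v' : M.toStarSubalgebra) : H →L[ℂ] H) = 1 - R := hv
      change (1 : H →L[ℂ] H) = ((∑ w : T, W w * star (W w) : M.toStarSubalgebra) : H →L[ℂ] H) +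
        ((star v' * v' : M.toStarSubalgebra) : H →L[ℂ] H)
      rw [h1, h2, hsum]
      abel
    rw [hone]
    exact I.add_mem (sum_mem fun w _ => hWI w) hvI
  · have hinf : T.Infinite := hfin
    let f := hinf.natEmbedding
    exact absurd hM.2.1 (not_isFiniteProjection_one he0 he (fun n => (f n : H →L[ℂ] H))
      (fun n => (hTw _ (f n).2).1) (fun n => (hTw _ (f n).2).2)
      (fun m n hmn => hTo (f m).2 (f n).2 (Subtype.coe_injective.ne (f.injective.ne hmn))))

/-- An infinite projection dominates infinitely many orthogonal copies of a nonzero projection: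
the successive differences of the ranges of the powers of a non-unitary isometry of the corner. -/
theorem exists_copies_of_infinite {e v : H →L[ℂ] H} (hvM : v ∈ M) (heM : e ∈ M)
    (he : IsStarProjection e) (hv : star v * v = e) (hev : e * v = v) (hne : v * star v ≠ e) :
    ∃ g ∈ M, IsStarProjection g ∧ g ≠ 0 ∧ ∃ w : ℕ → H →L[ℂ] H, (∀ n, w n ∈ M) ∧
      (∀ n, star (w n) * w n = g) ∧ (Pairwise fun m n => star (w m) * w n = 0) ∧
      ∀ n, e * w n = w n := by
  have hvp : IsPartialIsometry v := isPartialIsometry_of_isStarProjection (by rwa [hv])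
  have hve : v * e = v := by rw [← hv, ← mul_assoc]; exact hvp
  have hg : IsStarProjection (e - v * star v) :=
    he.sub_of_mul_eq_self hvp.isStarProjection' (by rw [← mul_assoc, hev])
  have hee := he.isIdempotentElem.eq
  set g := e - v * star v with hgdef
  have heg : e * g = g := by rw [hgdef, mul_sub, hee, ← mul_assoc, hev]
  have hvg : star v * g = 0 := by
    have h1 : star v * e = star v := by
      have := congrArg star hev
      rwa [star_mul, he.isSelfAdjoint.star_eq] at this
    rw [hgdef, mul_sub, h1, ← mul_assoc, hv]
    have := congrArg star hve
    rw [star_mul, he.isSelfAdjoint.star_eq] at this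
    rw [this, sub_self]
  have hgv : g * v = 0 := by
    have := congrArg star hvg
    rwa [star_mul, star_star, hg.isSelfAdjoint.star_eq, star_zero] at this
  have hstep : ∀ n, e * (v ^ n * g) = v ^ n * g := by
    intro n
    cases n with
    | zero => simpa using heg
    | succ n => rw [pow_succ', mul_assoc, ← mul_assoc e, hev]
  have hmove : ∀ m n, star (v ^ (m + 1) * g) * (v ^ (n + 1) * g) =
      star (v ^ m * g) * (v ^ n * g) := by
    intro m n
    calc star (v ^ (m + 1) * g) * (v ^ (n + 1) * g)
        = star (v ^ m * g) * ((star v * v) * (v ^ n * g)) := by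
          rw [pow_succ', pow_succ']; simp only [star_mul]; noncomm_ring
      _ = star (v ^ m * g) * (v ^ n * g) := by rw [hv, hstep]
  have hzero : ∀ n, star (v ^ 0 * g) * (v ^ (n + 1) * g) = 0 := by
    intro n
    rw [pow_zero, one_mul, hg.isSelfAdjoint.star_eq, pow_succ', mul_assoc, ← mul_assoc g, hgv,
      zero_mul]
  have hlt : ∀ m k, star (v ^ m * g) * (v ^ (m + k + 1) * g) = 0 := by
    intro m k
    induction m with
    | zero => simpa using hzero k
    | succ m ih => rw [show m + 1 + k + 1 = (m + k + 1) + 1 by ring, hmove, ih]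
  refine ⟨g, sub_mem heM (mul_mem hvM (star_mem hvM)), hg, sub_ne_zero.2 hne.symm,
    fun n => v ^ n * g, fun n => mul_mem (pow_mem hvM n) (sub_mem heM (mul_mem hvM (star_mem hvM))),
    fun n => ?_, fun m n hmn => ?_, hstep⟩
  · induction n with
    | zero => simp only [pow_zero, one_mul, hg.isSelfAdjoint.star_eq, hg.isIdempotentElem.eq]
    | succ n ih => rw [hmove, ih]
  · rcases lt_or_gt_of_ne hmn with h | h
    · obtain ⟨k, rfl⟩ := Nat.exists_eq_add_of_lt h
      exact hlt m k
    · obtain ⟨k, rfl⟩ := Nat.exists_eq_add_of_lt h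
      simpa using congrArg star (hlt n k)

theorem IsTypeIIIFactor.one_mem_ideal (hM : M.IsTypeIIIFactor)
    (hsep : TopologicalSpace.SeparableSpace M.predual)
    (I : TwoSidedIdeal M.toStarSubalgebra) (hI : I ≠ ⊥) : 1 ∈ I := by
  obtain ⟨e, heI, he, he0⟩ := exists_projection_mem_ideal I hI
  have hinf : ¬ IsFiniteProjection e := fun h => he0 (by rw [hM.2 e h]; rfl)
  have he' : IsStarProjection e := ⟨Subtype.ext he.isIdempotentElem, Subtype.ext he.isSelfAdjoint⟩
  obtain ⟨q, hq, heq, ⟨v, hve, hvq⟩, hqe⟩ : ∃ q : M.toStarSubalgebra, IsStarProjection q ∧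
      e * q = q ∧ MvNEquiv e q ∧ q ≠ e := by
    by_contra! h
    exact hinf ⟨he', h⟩
  have hev : e * v = v := by
    have h1 : IsPartialIsometry (v : H →L[ℂ] H) := isPartialIsometry_of_isStarProjection (by
      have : star (v : H →L[ℂ] H) * v = e := congrArg Subtype.val hve
      rwa [this])
    have h2 : v * star v * v = v := Subtype.ext h1
    rw [← h2, hvq, ← mul_assoc, heq]
  obtain ⟨g, hgM, hg, hg0, s, hsM, hs, hso, hes⟩ := exists_copies_of_infinite (M := M) v.2 e.2 he
    (congrArg Subtype.val hve) (congrArg Subtype.val hev)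
    (fun h => hqe (Subtype.ext (by rw [← hvq]; exact h)))
  obtain ⟨T, hTw, hTo, z, hzM, hz, hgz⟩ := hM.1.exists_maximal_copies hgM hg hg0
  have hwg : ∀ w : H →L[ℂ] H, star w * w = g → w * g = w := fun w hw =>
    mul_eq_self_of_star_mul_self hg.isSelfAdjoint (by rw [hw, hg.isIdempotentElem.eq])
  obtain ⟨k, hk⟩ := exists_injective_nat_of_orthogonal hsep (T := T)
    (fun w hw => ⟨(hTw w hw).1, isPartialIsometry_of_isStarProjection (by rwa [(hTw w hw).2]),
      fun h => hg0 (by rw [← (hTw w hw).2, h, mul_zero])⟩) hTo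
  -- the copies of `g` exhausting the unit are moved injectively onto the copies of `g` below `e`,
  -- the copy of index `0` being kept free for the remainder
  have hst : ∀ w : T, star (s (k w + 1) * star (w : H →L[ℂ] H)) =
      w * star (s (k w + 1)) := fun w => by simp
  obtain ⟨u, huM, hu, hl, hr, hi3, -⟩ := exists_sum_partial_isometry (M := M)
    (fun w : T => s (k w + 1) * star (w : H →L[ℂ] H))
    (fun w => mul_mem (hsM _) (star_mem (hTw w w.2).1))
    (fun w => by
      rw [IsPartialIsometry, hst]
      calc s (k w + 1) * star (w : H →L[ℂ] H) * (w * star (s (k w + 1))) *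
            (s (k w + 1) * star (w : H →L[ℂ] H))
          = s (k w + 1) * (star (w : H →L[ℂ] H) * w) * (star (s (k w + 1)) * s (k w + 1)) *
            star (w : H →L[ℂ] H) := by noncomm_ring
        _ = _ := by rw [(hTw w w.2).2, hs, hwg _ (hs _), hwg _ (hs _)])
    (fun w w' hne => by
      refine ⟨?_, ?_⟩
      · rw [hst, mul_assoc, ← mul_assoc (star (s (k w + 1))), hso (by simpa using hk.ne hne)]; simp
      · rw [hst, mul_assoc, ← mul_assoc (star (w : H →L[ℂ] H)),
          hTo w.2 w'.2 (Subtype.coe_injective.ne hne)]; simp)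
  set R := rangeProj (fun w : T => (w : H →L[ℂ] H)) with hR
  have hRp : IsStarProjection R := isStarProjection_rangeProj
  have huR : u * R = u := mul_eq_self_of_sub_eq_zero' (hr _ fun w => by
    have h1 := rangeProj_mul (b := fun w : T => (w : H →L[ℂ] H)) w
    have h2 := congrArg star h1
    rw [star_mul, ← hR, hRp.isSelfAdjoint.star_eq] at h2
    rw [mul_sub, mul_one, mul_assoc, h2, sub_self])
  have huu : star u * u = R := by
    have h1 : star u * u * R = 1 * R := mul_rangeProj_congr fun w => by
      have h1 := congrArg (· * s (k w + 1)) (hi3 w)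
      simp only [hst] at h1
      rwa [mul_assoc, mul_assoc (w : H →L[ℂ] H), hs, hwg _ (hTw w w.2).2, ← one_mul (w : H →L[ℂ] H),
        ← mul_assoc, mul_one] at h1
    rwa [mul_assoc, huR, one_mul] at h1
  have hsu : star (s 0) * u = 0 := hl _ fun w => by
    rw [← mul_assoc, hso (by simp), zero_mul]
  let V : M.toStarSubalgebra := ⟨u + s 0 * z, add_mem huM (mul_mem (hsM 0) hzM)⟩
  have heV : e * V = V := Subtype.ext <| by
    change (e : H →L[ℂ] H) * (u + s 0 * z) = u + s 0 * z
    have h1 : (e : H →L[ℂ] H) * u = u := mul_eq_self_of_sub_eq_zero (hl _ fun w => by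
      rw [← mul_assoc, sub_mul, one_mul, hes, sub_self, zero_mul])
    rw [mul_add, h1, ← mul_assoc, hes]
  have hVV : star V * V = 1 := Subtype.ext <| by
    change star (u + s 0 * z) * (u + s 0 * z) = 1
    have h1 : star u * s 0 = 0 := by simpa using congrArg star hsu
    calc star (u + s 0 * z) * (u + s 0 * z)
        = star u * u + (star u * s 0) * z + star z * (star (s 0) * u) +
          star z * ((star (s 0) * s 0) * z) := by
          simp only [star_add, star_mul]; noncomm_ring
      _ = 1 := by rw [huu, h1, hsu, hs, hgz, hz]; simp
  rw [← hVV, ← heV]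
  exact I.mul_mem_left _ _ (I.mul_mem_right _ _ heI)

end VonNeumannAlgebra

end Simple

/-! ### Order continuity and the action of automorphisms on the predual -/

section Normal

open Filter Topology

theorem ContinuousLinearMap.le_iff_inner_le {H : Type*} [NormedAddCommGroup H]
    [InnerProductSpace ℂ H] {a b : H →L[ℂ] H} :
    a ≤ b ↔ ∀ ξ : H, (inner ℂ ξ (a ξ) : ℂ) ≤ inner ℂ ξ (b ξ) := by
  rw [ContinuousLinearMap.le_def]
  constructor
  · intro h ξ
    have := h.inner_nonneg_right ξ
    rwa [sub_apply, inner_sub_right, sub_nonneg] at this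
  · intro h
    rw [ContinuousLinearMap.isPositive_iff_complex]
    intro ξ
    have h1 : (0 : ℂ) ≤ inner ℂ ξ ((b - a) ξ) := by
      rw [sub_apply, inner_sub_right, sub_nonneg]
      exact h ξ
    obtain ⟨hre, him⟩ := Complex.nonneg_iff.1 h1
    have h2 : (inner ℂ ((b - a) ξ) ξ : ℂ) = inner ℂ ξ ((b - a) ξ) := by
      rw [← inner_conj_symm]
      exact Complex.conj_eq_iff_im.2 him.symm
    rw [h2]
    exact ⟨Complex.ext rfl him, hre⟩

theorem re_inner_mono {H : Type*} [NormedAddCommGroup H] [InnerProductSpace ℂ H]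
    {a b : H →L[ℂ] H} (h : a ≤ b) (ξ : H) :
    (inner ℂ ξ (a ξ)).re ≤ (inner ℂ ξ (b ξ)).re :=
  (Complex.le_def.1 (ContinuousLinearMap.le_iff_inner_le.1 h ξ)).1

variable {H : Type*} [NormedAddCommGroup H] [InnerProductSpace ℂ H] [CompleteSpace H]

namespace VonNeumannAlgebra

variable {M : VonNeumannAlgebra H}

/-- A bounded increasing family of positive elements of `M` has a supremum in `M`, and the
supremum is approximated pointwise by the quadratic forms of the family. -/
theorem exists_sup_of_chain {C : Set (H →L[ℂ] H)} (hne : C.Nonempty)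
    (hC : IsChain (· ≤ ·) C) (hM : ∀ x ∈ C, x ∈ M) {b : H →L[ℂ] H}
    (h0 : ∀ x ∈ C, 0 ≤ x) (hb : ∀ x ∈ C, x ≤ b) :
    ∃ s ∈ M, (∀ x ∈ C, x ≤ s) ∧ (∀ y, (∀ x ∈ C, x ≤ y) → s ≤ y) ∧
      ∀ ξ : H, ∀ ε > 0, ∃ x ∈ C, (inner ℂ ξ (s ξ)).re < (inner ℂ ξ (x ξ)).re + ε := by
  have : Nonempty C := hne.to_subtype
  have : IsDirectedOrder C := directedOn_iff_isDirectedOrder.1 hC.directedOn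
  let U : Ultrafilter C := Ultrafilter.of atTop
  have hU : (U : Filter C) ≤ atTop := Ultrafilter.of_le _
  obtain ⟨s, hs⟩ := exists_weak_limit U (fun x : C => (x : H →L[ℂ] H)) ‖b‖
    (Eventually.of_forall fun x => CStarAlgebra.norm_le_norm_of_nonneg_of_le (h0 x x.2) (hb x x.2))
  refine ⟨s, mem_of_weak_limit hs (Eventually.of_forall fun x => hM x x.2), fun x hx => ?_,
    fun y hy => ?_, fun ξ ε hε => ?_⟩
  · refine ContinuousLinearMap.le_iff_inner_le.2 fun ξ => ge_of_tendsto (hs ξ ξ) ?_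
    filter_upwards [hU (eventually_ge_atTop ⟨x, hx⟩)] with z hz
    exact ContinuousLinearMap.le_iff_inner_le.1 hz ξ
  · refine ContinuousLinearMap.le_iff_inner_le.2 fun ξ => le_of_tendsto (hs ξ ξ) ?_
    exact Eventually.of_forall fun z => ContinuousLinearMap.le_iff_inner_le.1 (hy z z.2) ξ
  · have h1 := (Complex.continuous_re.tendsto _).comp (hs ξ ξ)
    have h2 : ∀ᶠ x : C in (U : Filter C),
        (inner ℂ ξ (s ξ)).re - ε < (inner ℂ ξ ((x : H →L[ℂ] H) ξ)).re :=
      h1.eventually (lt_mem_nhds (by linarith))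
    obtain ⟨x, hx⟩ := h2.exists
    exact ⟨x, x.2, by linarith⟩

variable (α : M.toStarSubalgebra ≃⋆ₐ[ℂ] M.toStarSubalgebra)

theorem automorphism_nonneg {x : M.toStarSubalgebra} (hx : 0 ≤ (x : H →L[ℂ] H)) :
    0 ≤ (α x : H →L[ℂ] H) := by
  obtain ⟨c, hc, hcs, hcc⟩ := exists_sqrt (M := M) x.2 hx
  have h1 : x = star (⟨c, hc⟩ : M.toStarSubalgebra) * ⟨c, hc⟩ := Subtype.ext (by
    change (x : H →L[ℂ] H) = star c * c
    rw [hcs.star_eq, hcc])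
  rw [h1, map_mul, map_star]
  exact star_mul_self_nonneg _

theorem automorphism_mono {x y : M.toStarSubalgebra} (h : (x : H →L[ℂ] H) ≤ y) :
    (α x : H →L[ℂ] H) ≤ α y := by
  have := automorphism_nonneg α (x := y - x) (sub_nonneg.2 h)
  rw [map_sub] at this
  exact sub_nonneg.1 this

theorem automorphism_norm_le (x : M.toStarSubalgebra) : ‖α x‖ ≤ 1 * ‖x‖ := by
  have hsm : algebraMap ℝ (H →L[ℂ] H) (‖x‖ ^ 2) = ((‖x‖ ^ 2 : ℝ) : ℂ) • 1 := by
    rw [Algebra.algebraMap_eq_smul_one]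
    exact (Complex.coe_smul _ _).symm
  have h1 : ((star x * x : M.toStarSubalgebra) : H →L[ℂ] H) ≤
      (((‖x‖ ^ 2 : ℝ) : ℂ) • (1 : M.toStarSubalgebra) : M.toStarSubalgebra) := by
    have := CStarAlgebra.star_mul_le_algebraMap_norm_sq (a := (x : H →L[ℂ] H))
    exact this.trans_eq hsm
  have h2 := automorphism_mono α h1
  rw [map_smul, map_one, map_mul, map_star] at h2
  have h3 : star (α x : H →L[ℂ] H) * (α x : H →L[ℂ] H) ≤ algebraMap ℝ _ (‖x‖ ^ 2) := by
    rw [hsm]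
    exact h2
  have h4 := (CStarAlgebra.norm_le_iff_le_algebraMap _ (sq_nonneg ‖x‖)
    (star_mul_self_nonneg _)).2 h3
  rw [CStarRing.norm_star_mul_self, ← sq] at h4
  rw [one_mul]
  exact abs_le_of_sq_le_sq' h4 (norm_nonneg _) |>.2

/-- A ⋆-automorphism as a bounded linear map. -/
noncomputable def automorphismCLM : M.toStarSubalgebra →L[ℂ] M.toStarSubalgebra :=
  LinearMap.mkContinuous { toFun := α, map_add' := map_add α, map_smul' := map_smul α } 1
    (automorphism_norm_le α)

@[simp]
theorem automorphismCLM_apply (x : M.toStarSubalgebra) : automorphismCLM α x = α x := rfl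

/-- Automorphisms preserve suprema of chains, because they are order isomorphisms. -/
theorem automorphism_sup_approx {C : Set (H →L[ℂ] H)} (hne : C.Nonempty)
    (hC : IsChain (· ≤ ·) C) (hM : ∀ x ∈ C, x ∈ M) (h0 : ∀ x ∈ C, 0 ≤ x)
    {s : H →L[ℂ] H} (hs : s ∈ M) (hub : ∀ x ∈ C, x ≤ s) (hlub : ∀ y, (∀ x ∈ C, x ≤ y) → s ≤ y)
    (ξ : H) {ε : ℝ} (hε : 0 < ε) :
    ∃ x, ∃ hx : x ∈ C, (inner ℂ ξ ((α ⟨s, hs⟩ : H →L[ℂ] H) ξ)).re <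
      (inner ℂ ξ ((α ⟨x, hM x hx⟩ : H →L[ℂ] H) ξ)).re + ε := by
  let C' : Set (H →L[ℂ] H) := {y | ∃ x, ∃ hx : x ∈ C, y = (α ⟨x, hM x hx⟩ : H →L[ℂ] H)}
  obtain ⟨s', hs', hub', -, happ⟩ := exists_sup_of_chain (M := M) (C := C')
    (b := (α ⟨s, hs⟩ : H →L[ℂ] H)) (by
      obtain ⟨x, hx⟩ := hne
      exact ⟨_, x, hx, rfl⟩)
    (by
      rintro _ ⟨x, hx, rfl⟩ _ ⟨y, hy, rfl⟩ -
      rcases hC.total hx hy with h | h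
      · exact Or.inl (automorphism_mono α h)
      · exact Or.inr (automorphism_mono α h))
    (by rintro _ ⟨x, hx, rfl⟩; exact (α _).2)
    (by rintro _ ⟨x, hx, rfl⟩; exact automorphism_nonneg α (h0 x hx))
    (by rintro _ ⟨x, hx, rfl⟩; exact automorphism_mono α (hub x hx))
  have hle : s ≤ (α.symm ⟨s', hs'⟩ : M.toStarSubalgebra) := hlub _ fun x hx => by
    have := automorphism_mono α.symm (x := α ⟨x, hM x hx⟩) (y := ⟨s', hs'⟩) (hub' _ ⟨x, hx, rfl⟩)
    rwa [StarAlgEquiv.symm_apply_apply] at this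
  have hle' := automorphism_mono α (x := ⟨s, hs⟩) hle
  rw [StarAlgEquiv.apply_symm_apply] at hle'
  obtain ⟨_, ⟨x, hx, rfl⟩, hlt⟩ := happ ξ ε hε
  exact ⟨x, hx, (re_inner_mono hle' ξ).trans_lt hlt⟩

/-- The positive functional `x ↦ ⟪ξ, α(x) ξ⟫` is dominated by a vector functional below some
nonzero positive `d ≤ b`. Here `b - d` is a maximal element below `b` on which the first
functional is at least the second. -/
theorem exists_dominated_below {b : H →L[ℂ] H} (hb : b ∈ M) (hb0 : 0 ≤ b) (hbne : b ≠ 0) (ξ : H) :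
    ∃ η : H, ∃ d ∈ M, 0 ≤ d ∧ d ≤ b ∧ d ≠ 0 ∧ ∀ y : M.toStarSubalgebra, 0 ≤ (y : H →L[ℂ] H) →
      (y : H →L[ℂ] H) ≤ d → (inner ℂ ξ ((α y : H →L[ℂ] H) ξ)).re ≤
        (inner ℂ η ((y : H →L[ℂ] H) η)).re := by
  obtain ⟨η, hη⟩ : ∃ η : H, (inner ℂ ξ ((α ⟨b, hb⟩ : H →L[ℂ] H) ξ)).re <
      (inner ℂ η (b η)).re := by
    obtain ⟨η₀, hη₀⟩ : ∃ η₀ : H, 0 < (inner ℂ η₀ (b η₀)).re := by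
      by_contra! h
      refine hbne (le_antisymm (ContinuousLinearMap.le_iff_inner_le.2 fun ζ => ?_) hb0)
      have h1 := Complex.le_def.1 (ContinuousLinearMap.le_iff_inner_le.1 hb0 ζ)
      refine Complex.le_def.2 ⟨by simpa using h ζ, by simpa using h1.2.symm⟩
    obtain ⟨n, hn⟩ := exists_nat_gt ((inner ℂ ξ ((α ⟨b, hb⟩ : H →L[ℂ] H) ξ)).re /
      (inner ℂ η₀ (b η₀)).re)
    refine ⟨((n + 1 : ℕ) : ℂ) • η₀, ?_⟩
    rw [div_lt_iff₀ hη₀] at hn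
    have h2 : (inner ℂ (((n + 1 : ℕ) : ℂ) • η₀) (b (((n + 1 : ℕ) : ℂ) • η₀))).re =
        ((n + 1 : ℕ) : ℝ) * (((n + 1 : ℕ) : ℝ) * (inner ℂ η₀ (b η₀)).re) := by
      rw [map_smul, inner_smul_left, inner_smul_right, Complex.conj_natCast,
        ← Complex.ofReal_natCast, Complex.re_ofReal_mul, Complex.re_ofReal_mul]
    rw [h2]
    push_cast
    have hn0 : (0 : ℝ) ≤ n := n.cast_nonneg
    nlinarith [mul_nonneg hn0 hη₀.le, mul_nonneg hn0 (mul_nonneg hn0 hη₀.le)]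
  let S : Set (H →L[ℂ] H) := {x | ∃ hx : x ∈ M, 0 ≤ x ∧ x ≤ b ∧
    (inner ℂ η (x η)).re ≤ (inner ℂ ξ ((α ⟨x, hx⟩ : H →L[ℂ] H) ξ)).re}
  obtain ⟨x₀, hx₀⟩ := zorn_le₀ S (by
    intro C hCS hC
    rcases C.eq_empty_or_nonempty with rfl | hne
    · exact ⟨0, ⟨zero_mem M, le_rfl, hb0, by
        have : α ⟨0, zero_mem M⟩ = 0 := map_zero α
        rw [this]; simp⟩, by simp⟩
    · have hCM : ∀ x ∈ C, x ∈ M := fun x hx => (hCS hx).1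
      have hC0 : ∀ x ∈ C, 0 ≤ x := fun x hx => (hCS hx).2.1
      obtain ⟨s, hsM, hub, hlub, happ⟩ := exists_sup_of_chain hne hC hCM hC0
        (fun x hx => (hCS hx).2.2.1)
      refine ⟨s, ⟨hsM, ?_, hlub b fun x hx => (hCS hx).2.2.1, ?_⟩, hub⟩
      · obtain ⟨x, hx⟩ := hne
        exact (hC0 x hx).trans (hub x hx)
      · refine le_of_forall_pos_le_add fun ε hε => ?_
        obtain ⟨x, hx, hlt⟩ := happ η ε hε
        have h1 := (hCS hx).2.2.2
        have h2 := re_inner_mono (automorphism_mono α (x := ⟨x, hCM x hx⟩) (y := ⟨s, hsM⟩)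
          (hub x hx)) ξ
        linarith)
  obtain ⟨hxM, hx0, hxb, hxle⟩ := hx₀.prop
  refine ⟨η, b - x₀, sub_mem hb hxM, sub_nonneg.2 hxb, sub_le_self b hx0, fun h => ?_,
    fun y hy0 hyd => ?_⟩
  · rw [sub_eq_zero] at h
    subst h
    exact absurd hxle (not_le.2 hη)
  · by_contra! hlt
    have hmem : x₀ + y ∈ S := by
      refine ⟨add_mem hxM y.2, add_nonneg hx0 hy0, by
        have := add_le_add_right hyd x₀; simpa using this, ?_⟩
      have h1 : α ⟨x₀ + y, add_mem hxM y.2⟩ = α ⟨x₀, hxM⟩ + α y := map_add α ⟨x₀, hxM⟩ y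
      rw [h1]
      change (inner ℂ η ((x₀ + (y : H →L[ℂ] H)) η)).re ≤
        (inner ℂ ξ (((α ⟨x₀, hxM⟩ : H →L[ℂ] H) + (α y : H →L[ℂ] H)) ξ)).re
      rw [add_apply, add_apply, inner_add_right, inner_add_right, Complex.add_re, Complex.add_re]
      linarith
    have h2 : x₀ + y ≤ x₀ := hx₀.2 hmem (le_add_of_nonneg_right hy0)
    have h3 : (y : H →L[ℂ] H) = 0 := le_antisymm (by simpa using h2) hy0
    have h4 : y = 0 := Subtype.ext h3
    rw [h4, map_zero] at hlt
    simp at hlt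

end VonNeumannAlgebra

end Normal

section NormalPredual

open Filter Topology

variable {H : Type*} [NormedAddCommGroup H] [InnerProductSpace ℂ H] [CompleteSpace H]

theorem norm_apply_sq_eq_re_inner (a : H →L[ℂ] H) (ξ : H) :
    ‖a ξ‖ ^ 2 = (inner ℂ ξ ((star a * a) ξ)).re := by
  rw [mul_apply_eq_comp, ContinuousLinearMap.star_eq_adjoint,
    ContinuousLinearMap.adjoint_inner_right, inner_self_eq_norm_sq_to_K]
  norm_cast

namespace VonNeumannAlgebra

variable {M : VonNeumannAlgebra H}

/-- A functional `f` on `M` with `‖f x‖ ≤ C ‖x v‖` is a vector functional at `v`, by extension and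
Riesz representation of the functional `x v ↦ f x`. -/
theorem exists_eq_vectorFunctional (f : StrongDual ℂ M.toStarSubalgebra) (v : H) (C : ℝ)
    (hf : ∀ x : M.toStarSubalgebra, ‖f x‖ ≤ C * ‖(x : H →L[ℂ] H) v‖) :
    ∃ ζ : H, f = vectorFunctional M ζ v := by
  let L : M.toStarSubalgebra →ₗ[ℂ] H :=
    { toFun := fun x => (x : H →L[ℂ] H) v
      map_add' := fun x y => rfl
      map_smul' := fun c x => rfl }
  have hmem : (f : M.toStarSubalgebra →ₗ[ℂ] ℂ) ∈ L.dualMap.range := by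
    rw [LinearMap.range_dualMap_eq_dualAnnihilator_ker, Submodule.mem_dualAnnihilator]
    intro x hx
    have h1 : (x : H →L[ℂ] H) v = 0 := hx
    have h2 := hf x
    rw [h1, norm_zero, mul_zero] at h2
    exact norm_le_zero_iff.1 h2
  obtain ⟨g, hg⟩ := hmem
  have hgx : ∀ x, g (L x) = f x := fun x => DFunLike.congr_fun hg x
  let F : StrongDual ℂ L.range := (g.domRestrict L.range).mkContinuous C (by
    rintro ⟨_, x, rfl⟩
    have := hf x
    rw [← hgx] at this
    exact this)
  obtain ⟨G, hG, -⟩ := exists_extension_norm_eq L.range F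
  refine ⟨(InnerProductSpace.toDual ℂ H).symm G, ContinuousLinearMap.ext fun x => ?_⟩
  rw [vectorFunctional_apply, InnerProductSpace.toDual_symm_apply]
  have h1 := hG ⟨L x, x, rfl⟩
  have h2 : F ⟨L x, x, rfl⟩ = g (L x) := rfl
  rw [h2, hgx] at h1
  exact h1.symm

/-- Precomposition with a bounded map preserves the predual as soon as it sends vector
functionals into the predual. -/
theorem comp_mem_predual {g : M.toStarSubalgebra →L[ℂ] M.toStarSubalgebra}
    (hg : ∀ ξ η : H, (vectorFunctional M ξ η).comp g ∈ M.predual)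
    {f : StrongDual ℂ M.toStarSubalgebra} (hf : f ∈ M.predual) : f.comp g ∈ M.predual := by
  have hle : M.predual ≤ M.predual.comap
      ((ContinuousLinearMap.precomp ℂ g : StrongDual ℂ M.toStarSubalgebra →L[ℂ]
        StrongDual ℂ M.toStarSubalgebra) : StrongDual ℂ M.toStarSubalgebra →ₗ[ℂ]
        StrongDual ℂ M.toStarSubalgebra) := by
    refine Submodule.topologicalClosure_minimal _ (Submodule.span_le.2 ?_) ?_
    · rintro f ⟨ξ, η, hf⟩
      have : f = vectorFunctional M ξ η := ContinuousLinearMap.ext hf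
      rw [this]
      exact hg ξ η
    · exact (Submodule.isClosed_topologicalClosure _).preimage
        (ContinuousLinearMap.precomp ℂ g).continuous
  exact hle hf

/-- Right multiplication by `c`. -/
noncomputable def rightMul (c : M.toStarSubalgebra) :
    M.toStarSubalgebra →L[ℂ] M.toStarSubalgebra :=
  (ContinuousLinearMap.mul ℂ M.toStarSubalgebra).flip c

@[simp]
theorem rightMul_apply (c x : M.toStarSubalgebra) : rightMul c x = x * c := rfl

theorem comp_rightMul_mem_predual (c : M.toStarSubalgebra)
    {f : StrongDual ℂ M.toStarSubalgebra} (hf : f ∈ M.predual) :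
    f.comp (rightMul c) ∈ M.predual :=
  comp_mem_predual (fun ξ η => vectorFunctional_mem_predual ξ ((c : H →L[ℂ] H) η)) hf

variable (α : M.toStarSubalgebra ≃⋆ₐ[ℂ] M.toStarSubalgebra)

/-- The functional `x ↦ ⟪ξ, α(x) ξ⟫`. -/
noncomputable def transported (ξ : H) : StrongDual ℂ M.toStarSubalgebra :=
  (vectorFunctional M ξ ξ).comp (automorphismCLM α)

theorem transported_apply (ξ : H) (x : M.toStarSubalgebra) :
    transported α ξ x = inner ℂ ξ ((α x : H →L[ℂ] H) ξ) := rfl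

/-- Below every nonzero `b ≥ 0` there is `d ≠ 0` such that `x ↦ ⟪ξ, α(x d) ξ⟫` is normal. -/
theorem exists_normal_below {b : H →L[ℂ] H} (hb : b ∈ M) (hb0 : 0 ≤ b) (hbne : b ≠ 0) (ξ : H) :
    ∃ d : M.toStarSubalgebra, 0 ≤ (d : H →L[ℂ] H) ∧ (d : H →L[ℂ] H) ≤ b ∧
      (d : H →L[ℂ] H) ≠ 0 ∧ (transported α ξ).comp (rightMul d) ∈ M.predual := by
  obtain ⟨η, d, hdM, hd0, hdb, hdne, hdom⟩ := exists_dominated_below α hb hb0 hbne ξ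
  obtain ⟨c, hcM, hcs, hcc⟩ := exists_sqrt hdM hd0
  let c' : M.toStarSubalgebra := ⟨c, hcM⟩
  have hbound : ∀ x : M.toStarSubalgebra,
      ‖(α (x * c') : H →L[ℂ] H) ξ‖ ≤ ‖(x : H →L[ℂ] H) (c η)‖ := by
    intro x
    let y : M.toStarSubalgebra := star (x * c') * (x * c')
    have hy0 : 0 ≤ (y : H →L[ℂ] H) := star_mul_self_nonneg _
    have hr : 0 < ‖star (x : H →L[ℂ] H) * x‖ + 1 := by positivity
    set r := ‖star (x : H →L[ℂ] H) * x‖ + 1 with hrdef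
    have hyd : (y : H →L[ℂ] H) ≤ r • d := by
      have h1 : (y : H →L[ℂ] H) = star c * (star (x : H →L[ℂ] H) * x) * c := by
        change star ((x : H →L[ℂ] H) * c) * (x * c) = _
        rw [star_mul]; noncomm_ring
      have h2 := CStarAlgebra.star_left_conjugate_le_norm_smul (a := c)
        (b := star (x : H →L[ℂ] H) * x) (.star_mul_self _)
      rw [← h1, hcs.star_eq, hcc] at h2
      refine h2.trans (smul_le_smul_of_nonneg_right (by linarith) hd0)
    have hsm : ((((r⁻¹ : ℝ) : ℂ) • y : M.toStarSubalgebra) : H →L[ℂ] H) =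
        r⁻¹ • (y : H →L[ℂ] H) := Complex.coe_smul _ _
    have h3 := hdom (((r⁻¹ : ℝ) : ℂ) • y)
      (by rw [hsm]; exact smul_nonneg (by positivity) hy0)
      (by
        rw [hsm]
        have := smul_le_smul_of_nonneg_left hyd (inv_nonneg.2 hr.le)
        rwa [smul_smul, inv_mul_cancel₀ hr.ne', one_smul] at this)
    have h4 : α (((r⁻¹ : ℝ) : ℂ) • y) = ((r⁻¹ : ℝ) : ℂ) • α y := map_smul α _ _
    have h5 : (inner ℂ ξ ((α (((r⁻¹ : ℝ) : ℂ) • y) : H →L[ℂ] H) ξ)).re =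
        r⁻¹ * (inner ℂ ξ ((α y : H →L[ℂ] H) ξ)).re := by
      rw [h4]
      change (inner ℂ ξ (((r⁻¹ : ℝ) : ℂ) • (α y : H →L[ℂ] H) ξ)).re = _
      rw [inner_smul_right, Complex.re_ofReal_mul]
    have h6 : (inner ℂ η (((((r⁻¹ : ℝ) : ℂ) • y : M.toStarSubalgebra) : H →L[ℂ] H) η)).re =
        r⁻¹ * (inner ℂ η ((y : H →L[ℂ] H) η)).re := by
      change (inner ℂ η (((r⁻¹ : ℝ) : ℂ) • (y : H →L[ℂ] H) η)).re = _
      rw [inner_smul_right, Complex.re_ofReal_mul]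
    rw [h5, h6] at h3
    have h7 := le_of_mul_le_mul_left h3 (by positivity)
    have h8 : (α y : H →L[ℂ] H) = star (α (x * c') : H →L[ℂ] H) * α (x * c') := by
      have : α y = star (α (x * c')) * α (x * c') := by rw [← map_star, ← map_mul]
      rw [this]; rfl
    rw [h8, ← norm_apply_sq_eq_re_inner] at h7
    have h9 : (inner ℂ η ((y : H →L[ℂ] H) η)).re = ‖((x : H →L[ℂ] H) * c) η‖ ^ 2 := by
      rw [norm_apply_sq_eq_re_inner]; rfl
    rw [h9] at h7
    exact abs_le_of_sq_le_sq' h7 (norm_nonneg _) |>.2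
  obtain ⟨ζ, hζ⟩ := exists_eq_vectorFunctional ((transported α ξ).comp (rightMul c')) (c η) ‖ξ‖
    (fun x => (norm_inner_le_norm _ _).trans (by gcongr; exact hbound x))
  refine ⟨⟨d, hdM⟩, hd0, hdb, hdne, ?_⟩
  have h1 : (transported α ξ).comp (rightMul ⟨d, hdM⟩) =
      ((transported α ξ).comp (rightMul c')).comp (rightMul c') := by
    refine ContinuousLinearMap.ext fun x => ?_
    have : x * ⟨d, hdM⟩ = x * c' * c' := Subtype.ext (by
      change (x : H →L[ℂ] H) * d = x * c * c
      rw [mul_assoc, hcc])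
    simp only [ContinuousLinearMap.comp_apply, rightMul_apply, this]
  rw [h1, hζ]
  exact comp_rightMul_mem_predual c' (vectorFunctional_mem_predual _ _)

theorem norm_apply_sq_le_re_inner {D : H →L[ℂ] H} (h0 : 0 ≤ D) (h1 : D ≤ 1) (ξ : H) :
    ‖D ξ‖ ^ 2 ≤ (inner ℂ ξ (D ξ)).re := by
  have hs := (CFC.sqrt_nonneg D).isSelfAdjoint
  have hm := CFC.sqrt_mul_sqrt_self D h0
  set e := CFC.sqrt D
  have hn : ‖e‖ ≤ 1 := by
    have h2 := (CStarAlgebra.norm_le_one_iff_of_nonneg D h0).2 h1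
    rw [← hm, hs.norm_mul_self] at h2
    nlinarith [norm_nonneg e]
  have h4 : (inner ℂ ξ (D ξ)).re = ‖e ξ‖ ^ 2 := by
    rw [norm_apply_sq_eq_re_inner, hs.star_eq, hm]
  rw [h4]
  have h5 : D ξ = e (e ξ) := by rw [← hm]; rfl
  rw [h5]
  gcongr
  calc ‖e (e ξ)‖ ≤ ‖e‖ * ‖e ξ‖ := e.le_opNorm _
    _ ≤ 1 * ‖e ξ‖ := by gcongr
    _ = ‖e ξ‖ := one_mul _

theorem norm_transported_comp_rightMul_le {D : M.toStarSubalgebra}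
    (h0 : 0 ≤ (D : H →L[ℂ] H)) (h1 : (D : H →L[ℂ] H) ≤ 1) (ξ : H) :
    ‖(transported α ξ).comp (rightMul D)‖ ≤
      ‖ξ‖ * Real.sqrt (inner ℂ ξ ((α D : H →L[ℂ] H) ξ)).re := by
  refine ContinuousLinearMap.opNorm_le_bound _ (by positivity) fun x => ?_
  have hα1 : (α D : H →L[ℂ] H) ≤ 1 := by
    have := automorphism_mono α (x := D) (y := 1) h1
    rwa [map_one] at this
  have h2 : ‖(α D : H →L[ℂ] H) ξ‖ ≤ Real.sqrt (inner ℂ ξ ((α D : H →L[ℂ] H) ξ)).re :=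
    Real.le_sqrt_of_sq_le (norm_apply_sq_le_re_inner (automorphism_nonneg α h0) hα1 ξ)
  have h3 : (α (x * D) : H →L[ℂ] H) ξ = (α x : H →L[ℂ] H) ((α D : H →L[ℂ] H) ξ) := by
    rw [map_mul]; rfl
  have h4 := automorphism_norm_le α x
  rw [one_mul] at h4
  calc ‖inner ℂ ξ ((α (x * D) : H →L[ℂ] H) ξ)‖ ≤ ‖ξ‖ * ‖(α (x * D) : H →L[ℂ] H) ξ‖ :=
        norm_inner_le_norm _ _
    _ ≤ ‖ξ‖ * (‖α x‖ * ‖(α D : H →L[ℂ] H) ξ‖) := by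
        rw [h3]; gcongr; exact (α x : H →L[ℂ] H).le_opNorm _
    _ ≤ ‖ξ‖ * (‖x‖ * Real.sqrt (inner ℂ ξ ((α D : H →L[ℂ] H) ξ)).re) := by gcongr
    _ = _ := by ring

/-- ⋆-automorphisms are normal on vector states: a maximal `c₀` in the unit interval of `M` such
that `x ↦ ⟪ξ, α(x c₀) ξ⟫` is normal must be the unit. -/
theorem transported_mem_predual (ξ : H) : transported α ξ ∈ M.predual := by
  let S : Set (H →L[ℂ] H) := {x | ∃ hx : x ∈ M, 0 ≤ x ∧ x ≤ 1 ∧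
    (transported α ξ).comp (rightMul ⟨x, hx⟩) ∈ M.predual}
  obtain ⟨c₀, hc₀⟩ := zorn_le₀ S (by
    intro C hCS hC
    rcases C.eq_empty_or_nonempty with rfl | hne
    · refine ⟨0, ⟨zero_mem M, le_rfl, zero_le_one, ?_⟩, by simp⟩
      convert zero_mem M.predual
      refine ContinuousLinearMap.ext fun x => ?_
      have : x * ⟨0, zero_mem M⟩ = 0 := mul_zero x
      simp [this]
    · have hCM : ∀ x ∈ C, x ∈ M := fun x hx => (hCS hx).1
      have hC0 : ∀ x ∈ C, 0 ≤ x := fun x hx => (hCS hx).2.1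
      obtain ⟨s, hsM, hub, hlub, -⟩ := exists_sup_of_chain hne hC hCM hC0
        (fun x hx => (hCS hx).2.2.1)
      have hs1 : s ≤ 1 := hlub 1 fun x hx => (hCS hx).2.2.1
      refine ⟨s, ⟨hsM, ?_, hs1, ?_⟩, hub⟩
      · obtain ⟨x, hx⟩ := hne
        exact (hC0 x hx).trans (hub x hx)
      · have hcl : IsClosed (M.predual : Set (StrongDual ℂ M.toStarSubalgebra)) :=
          Submodule.isClosed_topologicalClosure _
        rw [← SetLike.mem_coe, ← hcl.closure_eq, Metric.mem_closure_iff]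
        intro ε hε
        obtain ⟨x, hx, hlt⟩ := automorphism_sup_approx α hne hC hCM hC0 hsM hub hlub ξ
          (ε := (ε / (‖ξ‖ + 1)) ^ 2) (by positivity)
        refine ⟨_, (hCS hx).2.2.2, ?_⟩
        let D : M.toStarSubalgebra := ⟨s, hsM⟩ - ⟨x, hCM x hx⟩
        have hD0 : 0 ≤ (D : H →L[ℂ] H) := sub_nonneg.2 (hub x hx)
        have hD1 : (D : H →L[ℂ] H) ≤ 1 := (sub_le_self s (hC0 x hx)).trans hs1
        have hsub : (transported α ξ).comp (rightMul ⟨s, hsM⟩) -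
            (transported α ξ).comp (rightMul ⟨x, hCM x hx⟩) =
            (transported α ξ).comp (rightMul D) := by
          refine ContinuousLinearMap.ext fun y => ?_
          simp only [sub_apply, ContinuousLinearMap.comp_apply, rightMul_apply, D, mul_sub, map_sub]
        rw [dist_eq_norm, hsub]
        refine (norm_transported_comp_rightMul_le α hD0 hD1 ξ).trans_lt ?_
        have h1 : (inner ℂ ξ ((α D : H →L[ℂ] H) ξ)).re < (ε / (‖ξ‖ + 1)) ^ 2 := by
          have : α D = α ⟨s, hsM⟩ - α ⟨x, hCM x hx⟩ := map_sub α _ _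
          rw [this]
          change (inner ℂ ξ (((α ⟨s, hsM⟩ : H →L[ℂ] H) - (α ⟨x, hCM x hx⟩ : H →L[ℂ] H)) ξ)).re < _
          rw [sub_apply, inner_sub_right, Complex.sub_re]
          linarith
        have h2 : Real.sqrt (inner ℂ ξ ((α D : H →L[ℂ] H) ξ)).re < ε / (‖ξ‖ + 1) :=
          (Real.sqrt_lt' (by positivity)).2 h1
        calc ‖ξ‖ * Real.sqrt (inner ℂ ξ ((α D : H →L[ℂ] H) ξ)).re
            ≤ ‖ξ‖ * (ε / (‖ξ‖ + 1)) := by gcongr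
          _ < (‖ξ‖ + 1) * (ε / (‖ξ‖ + 1)) := by gcongr; linarith
          _ = ε := by field_simp)
  obtain ⟨hcM, hc0, hc1, hcpre⟩ := hc₀.prop
  have hone : c₀ = 1 := by
    by_contra hne
    obtain ⟨d, hd0, hd1, hdne, hdpre⟩ := exists_normal_below α (sub_mem (one_mem M) hcM)
      (sub_nonneg.2 hc1) (sub_ne_zero.2 (Ne.symm hne)) ξ
    have hmem : c₀ + d ∈ S := by
      refine ⟨add_mem hcM d.2, add_nonneg hc0 hd0, ?_, ?_⟩
      · rw [add_comm]
        exact le_sub_iff_add_le.1 hd1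
      · have hadd : (transported α ξ).comp (rightMul ⟨c₀ + d, add_mem hcM d.2⟩) =
            (transported α ξ).comp (rightMul ⟨c₀, hcM⟩) + (transported α ξ).comp (rightMul d) := by
          refine ContinuousLinearMap.ext fun y => ?_
          have : y * ⟨c₀ + d, add_mem hcM d.2⟩ = y * ⟨c₀, hcM⟩ + y * d := mul_add y ⟨c₀, hcM⟩ d
          simp only [add_apply, ContinuousLinearMap.comp_apply, rightMul_apply, this, map_add]
        rw [hadd]
        exact add_mem hcpre hdpre
    have h2 : c₀ + d ≤ c₀ := hc₀.2 hmem (le_add_of_nonneg_right hd0)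
    exact hdne (le_antisymm (by simpa using h2) hd0)
  subst hone
  convert hcpre
  refine ContinuousLinearMap.ext fun x => ?_
  have : x * ⟨1, hcM⟩ = x := mul_one x
  simp [this]

/-- ⋆-automorphisms of a von Neumann algebra act on its predual. -/
theorem comp_automorphism_mem_predual {f : StrongDual ℂ M.toStarSubalgebra} (hf : f ∈ M.predual) :
    f.comp (automorphismCLM α) ∈ M.predual := by
  refine comp_mem_predual (fun ξ η => ?_) hf
  -- polarization
  have hpol : (vectorFunctional M ξ η).comp (automorphismCLM α) =
      (1 / 4 : ℂ) • (transported α (ξ + η) - transported α (ξ - η) -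
        Complex.I • (transported α (ξ + Complex.I • η) - transported α (ξ - Complex.I • η))) := by
    refine ContinuousLinearMap.ext fun x => ?_
    simp only [smul_apply, sub_apply, transported_apply, ContinuousLinearMap.comp_apply,
      automorphismCLM_apply, vectorFunctional_apply, map_add, map_sub, map_smul, inner_add_left,
      inner_add_right, inner_sub_left, inner_sub_right, inner_smul_left, inner_smul_right,
      Complex.conj_I, smul_eq_mul]
    ring_nf
    simp only [Complex.I_sq]
    ring
  rw [hpol]
  have ht := transported_mem_predual α
  exact Submodule.smul_mem _ _ (sub_mem (sub_mem (ht _) (ht _))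
    (Submodule.smul_mem _ _ (sub_mem (ht _) (ht _))))

/-- An automorphism is determined by its action on a dense sequence of the separable predual, and
that action can be recorded by a double sequence of approximation indices. -/
theorem mk_automorphism_le_continuum (hsep : TopologicalSpace.SeparableSpace M.predual) :
    Cardinal.mk (M.toStarSubalgebra ≃⋆ₐ[ℂ] M.toStarSubalgebra) ≤ Cardinal.continuum := by
  obtain ⟨φ, hφmem, hφ⟩ := exists_dense_sequence_predual hsep
  choose code hcode using fun (α : M.toStarSubalgebra ≃⋆ₐ[ℂ] M.toStarSubalgebra) (n k : ℕ) =>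
    hφ _ (comp_automorphism_mem_predual α (hφmem n)) (1 / ((k : ℝ) + 1)) (by positivity)
  have hinj : Function.Injective code := by
    intro α β hαβ
    have h1 : ∀ n, (φ n).comp (automorphismCLM α) = (φ n).comp (automorphismCLM β) := by
      intro n
      rw [← sub_eq_zero, ← norm_le_zero_iff]
      refine le_of_forall_pos_lt_add fun ε hε => ?_
      obtain ⟨k, hk⟩ := exists_nat_one_div_lt (half_pos hε)
      have h2 := hcode α n k
      have h3 := hcode β n k
      rw [hαβ] at h2
      calc ‖(φ n).comp (automorphismCLM α) - (φ n).comp (automorphismCLM β)‖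
          = ‖((φ n).comp (automorphismCLM α) - φ (code β n k)) -
            ((φ n).comp (automorphismCLM β) - φ (code β n k))‖ := by rw [sub_sub_sub_cancel_right]
        _ ≤ _ := norm_sub_le _ _
        _ < 0 + ε := by linarith
    refine StarAlgEquiv.ext fun x => ?_
    -- the difference `α x - β x` is killed by the dense sequence, hence by all vector functionals
    have h2 : ∀ ψ ∈ M.predual, ψ (α x - β x) = 0 := by
      intro ψ hψ
      rw [← norm_le_zero_iff]
      refine le_of_forall_pos_le_add fun ε hε => ?_
      obtain ⟨n, hn⟩ := hφ ψ hψ (ε / (‖α x - β x‖ + 1)) (by positivity)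
      have h3 : φ n (α x - β x) = 0 := by
        rw [map_sub, sub_eq_zero]
        exact DFunLike.congr_fun (h1 n) x
      calc ‖ψ (α x - β x)‖ = ‖(ψ - φ n) (α x - β x)‖ := by rw [sub_apply, h3, sub_zero]
        _ ≤ ‖ψ - φ n‖ * ‖α x - β x‖ := (ψ - φ n).le_opNorm _
        _ ≤ (ε / (‖α x - β x‖ + 1)) * (‖α x - β x‖ + 1) := by gcongr; linarith
        _ = 0 + ε := by field_simp; ring
    have h3 : ((α x - β x : M.toStarSubalgebra) : H →L[ℂ] H) = 0 :=
      ContinuousLinearMap.ext fun η => ext_inner_left ℂ fun ξ => by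
        rw [zero_apply, inner_zero_right]
        exact h2 _ (vectorFunctional_mem_predual ξ η)
    exact sub_eq_zero.1 (Subtype.ext h3)
  have h := Cardinal.lift_mk_le_lift_mk_of_injective hinj
  simpa using h

end VonNeumannAlgebra

end NormalPredual

/-! ### Infinitely many orthogonal projections -/

section Splitting

open Filter Topology

variable {H : Type*} [NormedAddCommGroup H] [InnerProductSpace ℂ H] [CompleteSpace H]

namespace VonNeumannAlgebra

variable {M : VonNeumannAlgebra H}

/-- If `p` is a minimal projection, the only self-adjoint elements of `p M p` are the multiples of
`p`: two distinct nonzero spectral values would produce two orthogonal nonzero elements. -/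
theorem exists_smul_eq_of_minimal {p : H →L[ℂ] H} (hp : IsStarProjection p)
    (hmin : ∀ q ∈ M, IsStarProjection q → p * q = q → q = 0 ∨ q = p)
    {s : H →L[ℂ] H} (hs : s ∈ M) (hsa : IsSelfAdjoint s) (hps : p * s = s) :
    ∃ c : ℂ, s = c • p := by
  have hdiv : ∀ a ∈ M, 0 ≤ a → p * a = a → a ≠ 0 → ∀ y, y * a = 0 → y * p = 0 := by
    intro a ha ha0 hpa hane y hy
    obtain ⟨e, he, -, -, hep, hene, -, -, hker⟩ := exists_spectral_cut ha ha0 hane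
    have hpe : p * e = e := mul_eq_self_of_sub_eq_zero (hker _ (by
      rw [sub_mul, one_mul, hpa, sub_self]))
    rcases hmin e he hep hpe with h | h
    · exact absurd h hene
    · rw [← h]
      exact hker y hy
  have hsp : ∀ x ∈ spectrum ℝ s, ∀ y ∈ spectrum ℝ s, x ≠ 0 → y ≠ 0 → x = y := by
    intro x hx y hy hx0 hy0
    by_contra hne
    -- bumps around `x` and `y` with disjoint supports, vanishing at `0`
    have hδ : 0 < |x - y| / 2 := by
      have := abs_pos.2 (sub_ne_zero.2 hne)
      positivity
    let f : ℝ → ℝ → ℝ := fun z t => t * (t * max 0 (|x - y| / 2 - |t - z|))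
    have hfc : ∀ z, Continuous (f z) := fun z => by fun_prop
    have hfM : ∀ z, cfc (f z) s ∈ M := fun z => cfc_mem hs _
    have hf0 : ∀ z, 0 ≤ cfc (f z) s := fun z => cfc_nonneg fun t _ => by
      change 0 ≤ t * (t * max 0 (|x - y| / 2 - |t - z|))
      rw [← mul_assoc]
      exact mul_nonneg (mul_self_nonneg t) (le_max_left _ _)
    have hfp : ∀ z, p * cfc (f z) s = cfc (f z) s := fun z => by
      have h1 : cfc (f z) s = s * cfc (fun t : ℝ => t * max 0 (|x - y| / 2 - |t - z|)) s := by
        calc cfc (f z) s = cfc (fun t : ℝ => t) s *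
              cfc (fun t : ℝ => t * max 0 (|x - y| / 2 - |t - z|)) s := by
              rw [← cfc_mul _ _ s (by fun_prop) (by fun_prop)]
          _ = _ := by rw [cfc_id' ℝ s]
      rw [h1, ← mul_assoc, hps]
    have hfne : ∀ z ∈ spectrum ℝ s, z ≠ 0 → cfc (f z) s ≠ 0 := by
      intro z hz hz0 h
      have h1 : f z z ∈ spectrum ℝ (cfc (f z) s) := by
        rw [cfc_map_spectrum (f z) s hsa (hfc z).continuousOn]
        exact ⟨z, hz, rfl⟩
      have h2 : f z z ≠ 0 := by
        change z * (z * max 0 (|x - y| / 2 - |z - z|)) ≠ 0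
        rw [sub_self, abs_zero, sub_zero, max_eq_right hδ.le]
        exact mul_ne_zero hz0 (mul_ne_zero hz0 hδ.ne')
      rw [h] at h1
      have : Nontrivial (H →L[ℂ] H) := by
        by_contra hn
        rw [not_nontrivial_iff_subsingleton] at hn
        rw [spectrum.of_subsingleton] at h1
        exact h1
      rw [spectrum.zero_eq] at h1
      exact h2 h1
    have horth : cfc (f y) s * cfc (f x) s = 0 := by
      rw [← cfc_mul _ _ s (hfc y).continuousOn (hfc x).continuousOn, ← cfc_zero ℝ s]
      refine cfc_congr fun t _ => ?_
      have h1 : max 0 (|x - y| / 2 - |t - y|) * max 0 (|x - y| / 2 - |t - x|) = 0 := by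
        have h2 : |x - y| ≤ |t - x| + |t - y| := by
          have := abs_sub_le x t y
          rwa [abs_sub_comm x t] at this
        rcases le_total (|x - y| / 2) |t - y| with h | h
        · rw [max_eq_left (by linarith), zero_mul]
        · rw [max_eq_left (a := (0 : ℝ)) (b := |x - y| / 2 - |t - x|) (by linarith), mul_zero]
      change t * (t * max 0 (|x - y| / 2 - |t - y|)) * (t * (t * max 0 (|x - y| / 2 - |t - x|))) = 0
      linear_combination t ^ 4 * h1
    have h3 := hdiv _ (hfM x) (hf0 x) (hfp x) (hfne x hx hx0) _ horth
    have h4 := congrArg star h3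
    rw [star_mul, hp.isSelfAdjoint.star_eq, (hf0 y).isSelfAdjoint.star_eq, star_zero, hfp] at h4
    exact hfne y hy hy0 h4
  obtain ⟨r, hr⟩ : ∃ r : ℝ, ∀ x ∈ spectrum ℝ s, x * x = r * x := by
    by_cases h : ∃ x ∈ spectrum ℝ s, x ≠ 0
    · obtain ⟨r, hr, hr0⟩ := h
      refine ⟨r, fun x hx => ?_⟩
      rcases eq_or_ne x 0 with rfl | hx0
      · simp
      · rw [hsp x hx r hr hx0 hr0]
    · push Not at h
      exact ⟨0, fun x hx => by rw [h x hx]⟩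
  have hss : s * s = (r : ℂ) • s := by
    calc s * s = cfc (fun x : ℝ => x) s * cfc (fun x : ℝ => x) s := by rw [cfc_id' ℝ s]
      _ = cfc (fun x : ℝ => r * x) s := by
        rw [← cfc_mul _ _ s (by fun_prop) (by fun_prop)]
        exact cfc_congr hr
      _ = r • cfc (fun x : ℝ => x) s := by
        rw [← cfc_smul r (fun x : ℝ => x) s (by fun_prop)]
        rfl
      _ = (r : ℂ) • s := by rw [cfc_id' ℝ s]; exact (Complex.coe_smul r s).symm
  rcases eq_or_ne r 0 with hr0 | hr0
  · refine ⟨0, ?_⟩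
    rw [hr0, Complex.ofReal_zero, zero_smul] at hss
    rw [zero_smul, ← CStarRing.star_mul_self_eq_zero_iff, hsa.star_eq, hss]
  · have hrc : (r : ℂ) ≠ 0 := Complex.ofReal_ne_zero.2 hr0
    have he : IsStarProjection ((r : ℂ)⁻¹ • s) := by
      refine ⟨?_, ?_⟩
      · rw [IsIdempotentElem, smul_mul_smul_comm, hss, smul_smul]
        congr 1
        field_simp
      · rw [IsSelfAdjoint, star_smul, hsa.star_eq, star_inv₀]
        simp
    have hsr : s = (r : ℂ) • ((r : ℂ)⁻¹ • s) := by rw [smul_smul, mul_inv_cancel₀ hrc, one_smul]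
    rcases hmin _ (smul_mem' _ hs) he (by rw [mul_smul_comm, hps]) with h | h
    · exact ⟨0, by rw [hsr, h, smul_zero, zero_smul]⟩
    · exact ⟨r, by rw [← h]; exact hsr⟩

/-- A minimal projection is abelian. -/
theorem corner_comm_of_minimal {p : H →L[ℂ] H} (hpM : p ∈ M) (hp : IsStarProjection p)
    (hmin : ∀ q ∈ M, IsStarProjection q → p * q = q → q = 0 ∨ q = p)
    {a b : H →L[ℂ] H} (ha : a ∈ M) (hb : b ∈ M) :
    (p * a * p) * (p * b * p) = (p * b * p) * (p * a * p) := by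
  have hscalar : ∀ x ∈ M, ∃ c : ℂ, p * x * p = c • p := by
    intro x hx
    have hpp := hp.isIdempotentElem.eq
    have hsx : star (p * x * p) = p * star x * p := by
      rw [star_mul, star_mul, hp.isSelfAdjoint.star_eq, mul_assoc]
    set z := p * x * p with hz
    have hzM : z ∈ M := mul_mem (mul_mem hpM hx) hpM
    have hpz : p * z = z := by rw [hz, ← mul_assoc, ← mul_assoc, hpp]
    have hpz' : p * star z = star z := by rw [hsx, ← mul_assoc, ← mul_assoc, hpp]
    obtain ⟨c, hc⟩ := exists_smul_eq_of_minimal hp hmin (add_mem hzM (star_mem hzM))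
      (by rw [IsSelfAdjoint, star_add, star_star, add_comm]) (by rw [mul_add, hpz, hpz'])
    obtain ⟨d, hd⟩ := exists_smul_eq_of_minimal hp hmin
      (smul_mem' Complex.I (sub_mem (star_mem hzM) hzM))
      (by
        rw [IsSelfAdjoint, star_smul, star_sub, star_star, RCLike.star_def, Complex.conj_I,
          neg_smul, ← smul_neg, neg_sub])
      (by rw [mul_smul_comm, mul_sub, hpz, hpz'])
    refine ⟨(1 / 2 : ℂ) * (c + Complex.I * d), ?_⟩
    have h1 : z = (1 / 2 : ℂ) • ((z + star z) + Complex.I • (Complex.I • (star z - z))) := by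
      rw [smul_smul, Complex.I_mul_I]
      module
    rw [h1, hc, hd]
    module
  obtain ⟨c, hc⟩ := hscalar a ha
  obtain ⟨d, hd⟩ := hscalar b hb
  rw [hc, hd, smul_mul_smul_comm, smul_mul_smul_comm, mul_comm c d]

/-- There are no minimal projections in factors of type II₁ or III. -/
theorem exists_proper_subprojection (hM : M.IsTypeII₁Factor ∨ M.IsTypeIIIFactor)
    {p : H →L[ℂ] H} (hpM : p ∈ M) (hp : IsStarProjection p) (hp0 : p ≠ 0) :
    ∃ q ∈ M, IsStarProjection q ∧ p * q = q ∧ q ≠ 0 ∧ q ≠ p := by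
  have hp' : IsStarProjection (⟨p, hpM⟩ : M.toStarSubalgebra) :=
    ⟨Subtype.ext hp.isIdempotentElem, Subtype.ext hp.isSelfAdjoint⟩
  by_contra! hcon
  have hmin : ∀ q ∈ M, IsStarProjection q → p * q = q → q = 0 ∨ q = p := fun q hq hqp hpq =>
    or_iff_not_imp_left.2 (hcon q hq hqp hpq)
  rcases hM with hM | hM
  · exact hp0 (congrArg Subtype.val (hM.2.2 ⟨p, hpM⟩ ⟨hp', fun a b =>
      Subtype.ext (corner_comm_of_minimal hpM hp hmin a.2 b.2)⟩))
  · refine hp0 (congrArg Subtype.val (hM.2 ⟨p, hpM⟩ ⟨hp', fun q hq hpq huq => ?_⟩))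
    obtain ⟨u, hu1, hu2⟩ := huq
    have hq' : IsStarProjection (q : H →L[ℂ] H) :=
      ⟨congrArg Subtype.val hq.isIdempotentElem, congrArg Subtype.val hq.isSelfAdjoint⟩
    rcases hmin q q.2 hq' (congrArg Subtype.val hpq) with h | h
    · exfalso
      have h1 : (u : H →L[ℂ] H) * star (u : H →L[ℂ] H) = 0 := (congrArg Subtype.val hu2).trans h
      have h2 : star (u : H →L[ℂ] H) * u = p := congrArg Subtype.val hu1
      rw [CStarRing.mul_star_self_eq_zero_iff] at h1
      exact hp0 (by rw [← h2, h1, mul_zero])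
    · exact Subtype.ext h

theorem exists_orthogonal_projections (hM : M.IsTypeII₁Factor ∨ M.IsTypeIIIFactor) :
    ∃ p : ℕ → H →L[ℂ] H, (∀ n, p n ∈ M ∧ IsStarProjection (p n) ∧ p n ≠ 0) ∧
      Pairwise fun m n => p m * p n = 0 := by
  let P := {p : H →L[ℂ] H // p ∈ M ∧ IsStarProjection p ∧ p ≠ 0}
  have hone : (1 : H →L[ℂ] H) ≠ 0 := by
    have hnt : Nontrivial M.toStarSubalgebra := by
      rcases hM with h | h
      · exact h.1.1
      · exact h.1.1
    intro h
    exact one_ne_zero (α := M.toStarSubalgebra) (Subtype.ext h)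
  have hnext : ∀ p : P, ∃ q : P, (p : H →L[ℂ] H) * q = q ∧ (q : H →L[ℂ] H) ≠ p := fun p => by
    obtain ⟨q, hqM, hq, hpq, hq0, hqp⟩ := exists_proper_subprojection hM p.2.1 p.2.2.1 p.2.2.2
    exact ⟨⟨q, hqM, hq, hq0⟩, hpq, hqp⟩
  choose next hnext1 hnext2 using hnext
  let r : ℕ → P := fun n => next^[n] ⟨1, one_mem M, .one _, hone⟩
  have hr : ∀ n, r (n + 1) = next (r n) := fun n => Function.iterate_succ_apply' _ _ _
  have hstep : ∀ n, (r n : H →L[ℂ] H) * r (n + 1) = r (n + 1) := fun n => by rw [hr]; exact hnext1 _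
  have hle : ∀ n k, (r n : H →L[ℂ] H) * r (n + k) = r (n + k) := by
    intro n k
    induction k with
    | zero => exact (r n).2.2.1.isIdempotentElem.eq
    | succ k ih => rw [← add_assoc, ← hstep (n + k), ← mul_assoc, ih]
  have hp : ∀ n, IsStarProjection ((r n : H →L[ℂ] H) - r (n + 1)) := fun n =>
    (r n).2.2.1.sub_of_mul_eq_self (r (n + 1)).2.2.1 (hstep n)
  have horth : ∀ m k, ((r m : H →L[ℂ] H) - r (m + 1)) *
      ((r (m + k + 1) : H →L[ℂ] H) - r (m + k + 1 + 1)) = 0 := by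
    intro m k
    have h1 := hle m (k + 1)
    have h2 := hle m (k + 1 + 1)
    have h3 := hle (m + 1) k
    have h4 := hle (m + 1) (k + 1)
    rw [show m + 1 + k = m + k + 1 by ring] at h3
    rw [show m + 1 + (k + 1) = m + k + 1 + 1 by ring] at h4
    rw [← add_assoc] at h1
    rw [← add_assoc, ← add_assoc] at h2
    rw [sub_mul, mul_sub, mul_sub, h1, h2, h3, h4, sub_self]
  refine ⟨fun n => (r n : H →L[ℂ] H) - r (n + 1), fun n => ⟨sub_mem (r n).2.1 (r (n + 1)).2.1, hp n,
    sub_ne_zero.2 fun h => hnext2 (r n) (by rw [← hr, ← h])⟩, fun m n hmn => ?_⟩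
  rcases lt_or_gt_of_ne hmn with h | h
  · obtain ⟨k, rfl⟩ := Nat.exists_eq_add_of_lt h
    exact horth m k
  · obtain ⟨k, rfl⟩ := Nat.exists_eq_add_of_lt h
    have := congrArg star (horth n k)
    rwa [star_mul, (hp _).isSelfAdjoint.star_eq, (hp _).isSelfAdjoint.star_eq, star_zero] at this

end VonNeumannAlgebra

end Splitting

/-! ### Pure states -/

section PureStates

open Filter Topology

variable {H : Type*} [NormedAddCommGroup H] [InnerProductSpace ℂ H] [CompleteSpace H]

namespace VonNeumannAlgebra

variable {M : VonNeumannAlgebra H}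

theorem state_nonneg {f : StrongDual ℂ M.toStarSubalgebra} (hf : f ∈ stateSpace M.toStarSubalgebra)
    {a : M.toStarSubalgebra} (ha : 0 ≤ (a : H →L[ℂ] H)) : 0 ≤ f a := by
  obtain ⟨c, hc, hcs, hcc⟩ := exists_sqrt (M := M) a.2 ha
  have h1 : a = star (⟨c, hc⟩ : M.toStarSubalgebra) * ⟨c, hc⟩ := Subtype.ext (by
    change (a : H →L[ℂ] H) = star c * c
    rw [hcs.star_eq, hcc])
  rw [h1]
  exact hf.1 _

theorem norm_state_apply_le_of_isSelfAdjoint {f : StrongDual ℂ M.toStarSubalgebra}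
    (hf : f ∈ stateSpace M.toStarSubalgebra) {a : M.toStarSubalgebra}
    (ha : IsSelfAdjoint (a : H →L[ℂ] H)) : ‖f a‖ ≤ ‖a‖ := by
  have hsm : algebraMap ℝ (H →L[ℂ] H) ‖(a : H →L[ℂ] H)‖ = ((‖a‖ : ℝ) : ℂ) • 1 := by
    rw [Algebra.algebraMap_eq_smul_one]
    exact (Complex.coe_smul _ _).symm
  have h1 : 0 ≤ f (((‖a‖ : ℝ) : ℂ) • 1 - a) := state_nonneg hf (by
    change 0 ≤ ((‖a‖ : ℝ) : ℂ) • (1 : H →L[ℂ] H) - a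
    rw [← hsm]
    exact sub_nonneg.2 ha.le_algebraMap_norm_self)
  have h2 : 0 ≤ f (((‖a‖ : ℝ) : ℂ) • 1 + a) := state_nonneg hf (by
    change 0 ≤ ((‖a‖ : ℝ) : ℂ) • (1 : H →L[ℂ] H) + a
    rw [← hsm]
    exact neg_le_iff_add_nonneg'.1 ha.neg_algebraMap_norm_le_self)
  rw [map_sub, map_smul, hf.2, smul_eq_mul, mul_one] at h1
  rw [map_add, map_smul, hf.2, smul_eq_mul, mul_one] at h2
  obtain ⟨h3, h4⟩ := Complex.nonneg_iff.1 h1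
  obtain ⟨h5, -⟩ := Complex.nonneg_iff.1 h2
  simp only [Complex.sub_re, Complex.add_re, Complex.sub_im, Complex.ofReal_re,
    Complex.ofReal_im] at h3 h4 h5
  have h6 : f a = ((f a).re : ℂ) := Complex.ext rfl (by rw [Complex.ofReal_im]; linarith)
  rw [h6, Complex.norm_real, Real.norm_eq_abs, abs_le]
  constructor <;> linarith

theorem norm_state_le {f : StrongDual ℂ M.toStarSubalgebra}
    (hf : f ∈ stateSpace M.toStarSubalgebra) : ‖f‖ ≤ 2 := by
  refine f.opNorm_le_bound (by norm_num) fun a => ?_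
  have hstar : ‖star a‖ = ‖a‖ := norm_star (a : H →L[ℂ] H)
  have h1 := norm_state_apply_le_of_isSelfAdjoint hf (a := a + star a) (by
    change star ((a : H →L[ℂ] H) + star (a : H →L[ℂ] H)) = _
    rw [star_add, star_star, add_comm]; rfl)
  have h2 := norm_state_apply_le_of_isSelfAdjoint hf (a := Complex.I • (star a - a)) (by
    change star (Complex.I • (star (a : H →L[ℂ] H) - a)) = Complex.I • (star (a : H →L[ℂ] H) - a)
    rw [star_smul, star_sub, star_star, RCLike.star_def, Complex.conj_I, neg_smul, ← smul_neg,
      neg_sub])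
  have h3 : ‖a + star a‖ ≤ 2 * ‖a‖ := (norm_add_le _ _).trans (by rw [hstar]; linarith)
  have h4 : ‖Complex.I • (star a - a)‖ ≤ 2 * ‖a‖ := by
    rw [norm_smul, Complex.norm_I, one_mul]
    exact (norm_sub_le _ _).trans (by rw [hstar]; linarith)
  have h5 : f a = (1 / 2 : ℂ) * (f (a + star a) + Complex.I * f (Complex.I • (star a - a))) := by
    rw [map_smul, map_add, map_sub, smul_eq_mul, ← mul_assoc, Complex.I_mul_I]
    ring
  rw [h5, norm_mul]
  have h6 : ‖f (a + star a) + Complex.I * f (Complex.I • (star a - a))‖ ≤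
      ‖f (a + star a)‖ + ‖f (Complex.I • (star a - a))‖ := by
    refine (norm_add_le _ _).trans ?_
    rw [norm_mul, Complex.norm_I, one_mul]
  have h7 : ‖(1 / 2 : ℂ)‖ = 1 / 2 := by norm_num
  rw [h7]
  linarith

theorem vectorFunctional_mem_stateSpace {ξ : H} (hξ : ‖ξ‖ = 1) :
    vectorFunctional M ξ ξ ∈ stateSpace M.toStarSubalgebra := by
  constructor
  · intro a
    have h1 : 0 ≤ star (a : H →L[ℂ] H) * a := star_mul_self_nonneg _
    have h2 := ContinuousLinearMap.le_iff_inner_le.1 h1 ξ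
    rwa [zero_apply, inner_zero_right] at h2
  · change inner ℂ ξ ((1 : H →L[ℂ] H) ξ) = 1
    rw [one_apply_eq_self, inner_self_eq_norm_sq_to_K, hξ]
    simp

theorem isCompact_weakDual_stateSpace :
    IsCompact {f : WeakDual ℂ M.toStarSubalgebra |
      WeakDual.toStrongDual f ∈ stateSpace M.toStarSubalgebra} := by
  have hsub : {f : WeakDual ℂ M.toStarSubalgebra |
      WeakDual.toStrongDual f ∈ stateSpace M.toStarSubalgebra} ⊆
      WeakDual.toStrongDual ⁻¹' Metric.closedBall 0 2 := fun f hf =>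
    mem_closedBall_zero_iff.2 (norm_state_le hf)
  refine (WeakDual.isCompact_closedBall (𝕜 := ℂ) (E := M.toStarSubalgebra) 0 2).of_isClosed_subset
    ?_ hsub
  have h1 : {f : WeakDual ℂ M.toStarSubalgebra |
      WeakDual.toStrongDual f ∈ stateSpace M.toStarSubalgebra} =
      (⋂ a : M.toStarSubalgebra, {f : WeakDual ℂ M.toStarSubalgebra | 0 ≤ f (star a * a)}) ∩
        {f : WeakDual ℂ M.toStarSubalgebra | f 1 = 1} := by
    ext f
    simp [stateSpace]
  rw [h1]
  exact (isClosed_iInter fun a => isClosed_le continuous_const (WeakDual.eval_continuous _)).inter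
    (isClosed_eq (WeakDual.eval_continuous _) continuous_const)

instance locallyConvexSpace_weakDual {E : Type*} [NormedAddCommGroup E] [NormedSpace ℂ E] :
    LocallyConvexSpace ℝ (WeakDual ℂ E) := by
  let f : WeakDual ℂ E →ₗ[ℝ] (E → ℂ) :=
    { toFun := fun g x => g x
      map_add' := fun _ _ => rfl
      map_smul' := fun _ _ => rfl }
  have hf : Topology.IsInducing f := ⟨rfl⟩
  exact hf.locallyConvexSpace

theorem state_projection_mem_Icc {f : StrongDual ℂ M.toStarSubalgebra}
    (hf : f ∈ stateSpace M.toStarSubalgebra) {q : M.toStarSubalgebra}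
    (hq : IsStarProjection (q : H →L[ℂ] H)) : 0 ≤ f q ∧ f q ≤ 1 := by
  refine ⟨state_nonneg hf hq.nonneg, ?_⟩
  have := state_nonneg hf (a := 1 - q) hq.one_sub.nonneg
  rwa [map_sub, hf.2, sub_nonneg] at this

/-- The endpoints of the unit interval are extreme points. -/
theorem eq_of_convex_combination_eq {a b x y c : ℝ} (ha : 0 < a) (hb : 0 < b) (hab : a + b = 1)
    (hx0 : 0 ≤ x) (hx1 : x ≤ 1) (hy0 : 0 ≤ y) (hy1 : y ≤ 1) (hc : c = 0 ∨ c = 1)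
    (h : a * x + b * y = c) : x = c ∧ y = c := by
  have key : ∀ u v : ℝ, 0 ≤ u → 0 ≤ v → a * u + b * v = 0 → u = 0 ∧ v = 0 := by
    intro u v hu hv huv
    have h1 := mul_nonneg ha.le hu
    have h2 := mul_nonneg hb.le hv
    exact ⟨(mul_eq_zero.1 (by linarith : a * u = 0)).resolve_left ha.ne',
      (mul_eq_zero.1 (by linarith : b * v = 0)).resolve_left hb.ne'⟩
  rcases hc with rfl | rfl
  · exact key x y hx0 hy0 h
  · obtain ⟨h1, h2⟩ := key (1 - x) (1 - y) (by linarith) (by linarith) (by linarith)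
    constructor <;> linarith

/-- Prescribing the values `0` and `1` on a family of projections defines a face of the state
space. If finitely many prescriptions are always compatible, the face contains a pure state, by
compactness and the Krein–Milman theorem. -/
theorem exists_pureState_of_finite {I : Type*} (q : I → M.toStarSubalgebra)
    (hq : ∀ i, IsStarProjection (q i : H →L[ℂ] H)) (c : I → ℂ) (hc : ∀ i, c i = 0 ∨ c i = 1)
    (hfin : ∀ F : Finset I, ∃ f ∈ stateSpace M.toStarSubalgebra, ∀ i ∈ F, f (q i) = c i) :
    ∃ f ∈ pureStateSpace M.toStarSubalgebra, ∀ i, f (q i) = c i := by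
  let S : Set (WeakDual ℂ M.toStarSubalgebra) :=
    {f | WeakDual.toStrongDual f ∈ stateSpace M.toStarSubalgebra}
  let t : I → Set (WeakDual ℂ M.toStarSubalgebra) := fun i => {f | f (q i) = c i}
  have ht : ∀ i, IsClosed (t i) := fun i =>
    isClosed_eq (WeakDual.eval_continuous _) continuous_const
  have hne : (S ∩ ⋂ i, t i).Nonempty := by
    refine isCompact_weakDual_stateSpace.inter_iInter_nonempty t ht fun F => ?_
    obtain ⟨f, hf, hfF⟩ := hfin F
    refine ⟨StrongDual.toWeakDual f, hf, ?_⟩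
    simp only [Set.mem_iInter]
    exact fun i hi => hfF i hi
  have hcomp : IsCompact (S ∩ ⋂ i, t i) :=
    isCompact_weakDual_stateSpace.inter_right (isClosed_iInter ht)
  obtain ⟨f, hf⟩ := hcomp.extremePoints_nonempty hne
  have hfS := hf.1
  have hfq : ∀ i, f (q i) = c i := fun i => Set.mem_iInter.1 hfS.2 i
  refine ⟨WeakDual.toStrongDual f, ?_, hfq⟩
  rw [pureStateSpace, mem_extremePoints]
  refine ⟨hfS.1, ?_⟩
  rintro g₁ hg₁ g₂ hg₂ ⟨a, b, ha, hb, hab, hgf⟩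
  have hface : ∀ i, g₁ (q i) = c i ∧ g₂ (q i) = c i := by
    intro i
    obtain ⟨h1, h2⟩ := state_projection_mem_Icc hg₁ (hq i)
    obtain ⟨h3, h4⟩ := state_projection_mem_Icc hg₂ (hq i)
    have h5 : (a : ℂ) * g₁ (q i) + (b : ℂ) * g₂ (q i) = c i := by
      have := DFunLike.congr_fun hgf (q i)
      rw [← hfq i]
      exact this
    have h6 := congrArg Complex.re h5
    rw [Complex.add_re, Complex.re_ofReal_mul, Complex.re_ofReal_mul] at h6
    obtain ⟨h1r, h1i⟩ := Complex.le_def.1 h1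
    obtain ⟨h2r, -⟩ := Complex.le_def.1 h2
    obtain ⟨h3r, h3i⟩ := Complex.le_def.1 h3
    obtain ⟨h4r, -⟩ := Complex.le_def.1 h4
    simp only [Complex.zero_re, Complex.zero_im, Complex.one_re] at h1r h1i h2r h3r h3i h4r
    have hci : (c i).im = 0 := by rcases hc i with h | h <;> simp [h]
    obtain ⟨h7, h8⟩ := eq_of_convex_combination_eq ha hb hab h1r h2r h3r h4r
      (by rcases hc i with h | h <;> simp [h]) h6
    exact ⟨Complex.ext h7 (h1i.symm.trans hci.symm), Complex.ext h8 (h3i.symm.trans hci.symm)⟩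
  have h1 := hf.2 (x₁ := StrongDual.toWeakDual g₁) ⟨hg₁, Set.mem_iInter.2 fun i => (hface i).1⟩
    (x₂ := StrongDual.toWeakDual g₂) ⟨hg₂, Set.mem_iInter.2 fun i => (hface i).2⟩
    ⟨a, b, ha, hb, hab, hgf⟩
  have h2 := hf.2 (x₁ := StrongDual.toWeakDual g₂) ⟨hg₂, Set.mem_iInter.2 fun i => (hface i).2⟩
    (x₂ := StrongDual.toWeakDual g₁) ⟨hg₁, Set.mem_iInter.2 fun i => (hface i).1⟩
    ⟨b, a, hb, ha, by rw [add_comm, hab], by rw [add_comm]; exact hgf⟩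
  exact ⟨h1, h2⟩

end VonNeumannAlgebra

open Classical in
/-- An independent family of subsets of a countable set, indexed by the sets `A` of natural
numbers: the pair `(D, 𝒢)` belongs to the set of index `A` when the trace of `A` on `D` belongs
to `𝒢`. -/
def independentFamily (A : Set ℕ) : Set (Finset ℕ × Finset (Finset ℕ)) :=
  {i | i.1.filter (· ∈ A) ∈ i.2}

/-- Any finite pattern of memberships in the independent family is realised: `D` is taken to
separate the finitely many sets involved. -/
theorem exists_pattern_independentFamily (P : Set (Set ℕ)) (F : Finset (Set ℕ)) :
    ∃ i, ∀ A ∈ F, (i ∈ independentFamily A ↔ A ∈ P) := by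
  classical
  have hsep : ∀ A B : Set ℕ, ∃ n, A ≠ B → ¬(n ∈ A ↔ n ∈ B) := by
    intro A B
    by_contra! h
    exact (h 0).1 (Set.ext fun n => (h n).2)
  choose d hd using hsep
  let D : Finset ℕ := (F ×ˢ F).image fun x => d x.1 x.2
  refine ⟨(D, (F.filter (· ∈ P)).image fun B => D.filter (· ∈ B)), fun A hA => ?_⟩
  simp only [independentFamily, Set.mem_ofPred_eq, Finset.mem_image, Finset.mem_filter]
  constructor
  · rintro ⟨B, ⟨hB, hBP⟩, hBA⟩
    by_cases hAB : A = B
    · rwa [hAB]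
    · exfalso
      have hmem : d A B ∈ D := Finset.mem_image.2 ⟨(A, B), Finset.mem_product.2 ⟨hA, hB⟩, rfl⟩
      have h1 := Finset.ext_iff.1 hBA (d A B)
      simp only [Finset.mem_filter, hmem, true_and] at h1
      exact hd A B hAB h1.symm
  · exact fun hAP => ⟨A, ⟨hA, hAP⟩, rfl⟩

namespace VonNeumannAlgebra

variable {M : VonNeumannAlgebra H}

/-- Infinitely many orthogonal nonzero projections produce `2 ^ 𝔠` pure states: the projections
attached to the members of an independent family take every `0`-`1` pattern on some pure state. -/
theorem two_power_continuum_le_mk_pureStateSpace {p : ℕ → H →L[ℂ] H}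
    (hp : ∀ n, p n ∈ M ∧ IsStarProjection (p n) ∧ p n ≠ 0)
    (ho : Pairwise fun m n => p m * p n = 0) :
    2 ^ Cardinal.continuum ≤ Cardinal.mk (pureStateSpace M.toStarSubalgebra) := by
  classical
  let P : Finset ℕ × Finset (Finset ℕ) → H →L[ℂ] H := fun i => p (Encodable.encode i)
  let q : Set ℕ → M.toStarSubalgebra := fun A =>
    ⟨rangeProj fun i : independentFamily A => P i, rangeProj_mem fun i => (hp _).1⟩
  have hq : ∀ A, IsStarProjection (q A : H →L[ℂ] H) := fun A => isStarProjection_rangeProj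
  have hvec : ∀ i, ∃ ξ : H, ‖ξ‖ = 1 ∧ P i ξ = ξ := by
    intro i
    obtain ⟨-, h1, h2⟩ := hp (Encodable.encode i)
    obtain ⟨η, hη⟩ : ∃ η, P i η ≠ 0 := by
      by_contra! h
      exact h2 (ContinuousLinearMap.ext h)
    refine ⟨((‖P i η‖⁻¹ : ℝ) : ℂ) • P i η, ?_, ?_⟩
    · rw [norm_smul, Complex.norm_real, norm_inv, norm_norm,
        inv_mul_cancel₀ (norm_ne_zero_iff.2 hη)]
    · rw [map_smul]
      congr 1
      exact DFunLike.congr_fun h1.isIdempotentElem.eq η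
  have hmem : ∀ A i, i ∈ independentFamily A → ∀ ξ, P i ξ = ξ → (q A : H →L[ℂ] H) ξ = ξ := by
    intro A i hi ξ hξ
    have h1 := DFunLike.congr_fun
      (rangeProj_mul (b := fun i : independentFamily A => P i) ⟨i, hi⟩) ξ
    rw [mul_apply_eq_comp, hξ] at h1
    exact h1
  have hnot : ∀ A i, i ∉ independentFamily A → ∀ ξ, P i ξ = ξ → (q A : H →L[ℂ] H) ξ = 0 := by
    intro A i hi ξ hξ
    have h1 : P i * (q A : H →L[ℂ] H) = 0 := mul_rangeProj_eq_zero fun j =>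
      ho (Encodable.encode_injective.ne fun h => hi (h ▸ j.2))
    have h2 := congrArg star h1
    rw [star_mul, (hq A).isSelfAdjoint.star_eq, (hp _).2.1.isSelfAdjoint.star_eq, star_zero] at h2
    rw [← hξ]
    exact DFunLike.congr_fun h2 ξ
  have hex : ∀ X : Set (Set ℕ), ∃ f ∈ pureStateSpace M.toStarSubalgebra,
      ∀ A, f (q A) = if A ∈ X then 1 else 0 := by
    intro X
    refine exists_pureState_of_finite q hq _ (fun A => by split_ifs <;> simp) fun F => ?_
    obtain ⟨i, hi⟩ := exists_pattern_independentFamily X F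
    obtain ⟨ξ, hξ1, hξ⟩ := hvec i
    refine ⟨vectorFunctional M ξ ξ, vectorFunctional_mem_stateSpace hξ1, fun A hA => ?_⟩
    rw [vectorFunctional_apply]
    split_ifs with hAX
    · rw [hmem A i ((hi A hA).2 hAX) ξ hξ, inner_self_eq_norm_sq_to_K, hξ1]
      simp
    · rw [hnot A i (fun h => hAX ((hi A hA).1 h)) ξ hξ, inner_zero_right]
  choose g hg hgq using hex
  have hinj : Function.Injective fun X => (⟨g X, hg X⟩ : pureStateSpace M.toStarSubalgebra) := by
    intro X Y hXY
    have h1 : g X = g Y := congrArg Subtype.val hXY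
    ext A
    have h2 := hgq X A
    rw [h1, hgq Y A] at h2
    by_cases hX : A ∈ X <;> by_cases hY : A ∈ Y <;> simp [hX, hY] at h2 ⊢
  have h := Cardinal.lift_mk_le_lift_mk_of_injective hinj
  simpa using h

/-- A norm-separable space has only `𝔠` bounded functionals. -/
theorem mk_strongDual_le_continuum {E : Type*} [NormedAddCommGroup E] [NormedSpace ℂ E]
    [TopologicalSpace.SeparableSpace E] : Cardinal.mk (StrongDual ℂ E) ≤ Cardinal.continuum := by
  have hinj : Function.Injective
      fun (f : StrongDual ℂ E) (n : ℕ) => f (TopologicalSpace.denseSeq E n) := by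
    intro f g hfg
    refine DFunLike.coe_injective ((TopologicalSpace.denseRange_denseSeq E).equalizer
      f.continuous g.continuous hfg)
  have h := Cardinal.lift_mk_le_lift_mk_of_injective hinj
  simpa using h

end VonNeumannAlgebra

end PureStates

/-! ### Simplicity, cardinalities and inhomogeneity -/

open VonNeumannAlgebra in
theorem mainTheorem6 {H : Type*} [NormedAddCommGroup H] [InnerProductSpace ℂ H] [CompleteSpace H]
    (M : VonNeumannAlgebra H) (hM : M.IsTypeII₁Factor ∨ M.IsTypeIIIFactor)
    (hsep : TopologicalSpace.SeparableSpace M.predual) :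
    IsSimpleCStar M.toStarSubalgebra ∧
    ¬ TopologicalSpace.SeparableSpace M.toStarSubalgebra ∧
    2 ^ Cardinal.continuum ≤ Cardinal.mk (pureStateSpace M.toStarSubalgebra) ∧
    Cardinal.mk (M.toStarSubalgebra ≃⋆ₐ[ℂ] M.toStarSubalgebra) ≤ Cardinal.continuum ∧
    ¬ PureStateSpaceHomogeneous M.toStarSubalgebra := by
  obtain ⟨p, hp, ho⟩ := exists_orthogonal_projections hM
  have hpure := two_power_continuum_le_mk_pureStateSpace hp ho
  have haut := mk_automorphism_le_continuum hsep
  refine ⟨⟨?_, fun I _ => ?_⟩, fun hnorm => ?_, hpure, haut, fun hhom => ?_⟩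
  · rcases hM with h | h
    · exact h.1.1
    · exact h.1.1
  · refine or_iff_not_imp_left.2 fun hI => (TwoSidedIdeal.one_mem_iff I).1 ?_
    rcases hM with h | h
    · exact h.one_mem_ideal I hI
    · exact h.one_mem_ideal hsep I hI
  · exact absurd (hpure.trans ((Cardinal.mk_subtype_le _).trans mk_strongDual_le_continuum))
      (not_le.2 (Cardinal.cantor _))
  · -- a single orbit of the automorphism group has at most `𝔠` elements
    have hne : Nonempty (pureStateSpace M.toStarSubalgebra) := by
      rw [← Cardinal.mk_ne_zero_iff]
      intro h0
      rw [h0] at hpure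
      exact absurd hpure (not_le.2 (Cardinal.power_pos _ two_pos))
    obtain ⟨ω⟩ := hne
    choose α hα using fun ω' : pureStateSpace M.toStarSubalgebra => hhom ω ω.2 ω' ω'.2
    have hinj : Function.Injective α := fun ω₁ ω₂ h =>
      Subtype.ext (ContinuousLinearMap.ext fun a => by rw [hα ω₁ a, hα ω₂ a, h])
    exact absurd (hpure.trans ((Cardinal.mk_le_of_injective hinj).trans haut))
      (not_le.2 (Cardinal.cantor _))
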